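/- Let $W$ be a finite group, and let $\psi': W \to \mathrm{GL}(V')$ and $\psi: W \to \mathrm{GL}(V)$ be finite-dimensional real representations. A fan is a nonempty finite collection of polyhedral cones whose minimal face is the origin, closed under taking faces, in which any two cones meet in a common face. Let $\Sigma'$ and $\Sigma$ be $W$-invariant fans in $V'$ and $V$, and let $\phi: V' \to V$ be a surjective $W$-equivariant linear map which maps each cone of $\Sigma'$ into some cone of $\Sigma$ and satisfies $\phi^{-1}(|\Sigma|) = |\Sigma'|$, where $|\cdot|$ denotes the union of the cones. Let $X$ and $Y$ be the posets of cones of $\Sigma'$ and $\Sigma$, ordered by inclusion, and let $\sigma: X \to Y$ send $C'$ to the smallest cone of $\Sigma$ containing $\phi(C')$. Let $\Gamma$ be the mapping cylinder of $\sigma$: the disjoint union of $X$ and $Y$, with the given orders on $X$ and $Y$, with $x \le y$ if and only if $\sigma(x) \le y$ for $x \in X$, $y \in Y$, and with no relation $y \le x$. The group $W$ acts on the poset $\Gamma$. Write $W_{z,z'}$ and $W_{z,z'',z'}$ for the subgroups of elements of $W$ fixing $z,z'$, respectively $z,z'',z'$, and $\Gamma^w$ for the subposet of elements fixed by $w$.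 A function $\rho: B \to \mathbb{Z}$ on a finite poset $B$ is a rank function if $\rho(z') = \rho(z)+1$ whenever $z'$ covers $z$. The poset $B$ is lower Eulerian if it has a unique minimal element and a rank function $\rho$ with $\sum_{z \le z'' \le z'} (-1)^{\rho(z'')} = 0$ for all $z < z'$; then $\rho_B(z,z') := \rho(z') - \rho(z)$ for $z \le z'$ is its natural weak rank function. Let $R(G)$ be the complex representation ring of a finite group $G$, and for $g \in G$ let $\mathrm{ev}_g: R(G)[t] \to \mathbb{C}[t]$ be the evaluation of characters at $g$. For a representation $\theta$ of $G$ on a vector space $U$ of dimension $d$ (complexified if real) put $\det(tI - \theta) = \sum_{m=0}^{d} (-1)^m [\bigwedge^m U]\, t^{d-m} \in R(G)[t]$. For $z \in \Gamma$ let $V'_z \subset V'$ be the linear span of $C'$ if $z = C' \in X$, and of $\phi^{-1}(C)$ if $z = C \in Y$. For $z \le z'$ in $\Gamma$ let $\psi_{z,z'}: W_{z,z'} \to \mathrm{GL}(V'_{z'}/V'_z)$ be the representation induced by $\psi'$, and set $$\kappa_\Gamma(z,z') = \begin{cases} (t-1)\det(tI - \psi_{z,z'}) & \text{if } z \in X,\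 z' \in Y, \\ \det(tI - \psi_{z,z'}) & \text{otherwise,} \end{cases} \qquad \kappa_\Gamma(z,z') \in R(W_{z,z'})[t].$$ Then the following hold. 1. The action of $W$ on $\Gamma$ is Eulerian: $\Gamma$ is lower Eulerian and $\Gamma^w$ is lower Eulerian for every $w \in W$. The natural weak rank function $\rho_\Gamma$ is a $W$-invariant weak rank function, that is, $\rho_\Gamma(z,z') > 0$ for $z < z'$, $\rho_\Gamma(z,z') = \rho_\Gamma(z,z'') + \rho_\Gamma(z'',z')$ for $z \le z'' \le z'$, and $\rho_\Gamma(wz,wz') = \rho_\Gamma(z,z')$ for $w \in W$ and $z \le z'$. 2. $\kappa_\Gamma$ lies in the equivariant incidence algebra $I^W(\Gamma)$, that is, for all $w \in W$ and $z \le z'$, $\kappa_\Gamma(z,z')$ is the pullback of $\kappa_\Gamma(wz,wz')$ along $W_{z,z'} \to W_{wz,wz'}$, $v \mapsto wvw^{-1}$. Moreover $\deg \kappa_\Gamma(z,z') \le \rho_\Gamma(z,z')$ for all $z \le z'$, and $\kappa_\Gamma(z,z) = 1$ for all $z$. 3. $\kappa_\Gamma$ is multiplicative: $\mathrm{ev}_w(\kappa_\Gamma(z,z'))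 = \mathrm{ev}_w(\kappa_\Gamma(z,z''))\,\mathrm{ev}_w(\kappa_\Gamma(z'',z'))$ for all $w \in W$ and $z \le z'' \le z'$ in $\Gamma^w$. 4. $\kappa_\Gamma$ is rank alternating: with $\kappa_\Gamma^{\mathrm{rev}}(z,z';t) = t^{\rho_\Gamma(z,z')} \kappa_\Gamma(z,z';t^{-1})$, one has $\mathrm{ev}_w(\kappa_\Gamma^{\mathrm{rev}}(z,z')) = (-1)^{\rho_{\Gamma^w}(z,z')}\, \mathrm{ev}_w(\kappa_\Gamma(z,z'))$ for all $w \in W$ and $z \le z'$ in $\Gamma^w$. 5. Hence $\kappa_\Gamma$ is an equivariant $\Gamma$-kernel: $\kappa_\Gamma^{-1} = \kappa_\Gamma^{\mathrm{rev}}$ for the product $$(p \cdot p')(z,z') = \sum_{z \le z'' \le z'} \frac{|W_{z,z'',z'}|}{|W_{z,z'}|}\, \mathrm{Ind}^{W_{z,z'}}_{W_{z,z'',z'}} \left( \mathrm{Res}^{W_{z,z''}}_{W_{z,z'',z'}} p(z,z'') \cdot \mathrm{Res}^{W_{z'',z'}}_{W_{z,z'',z'}} p'(z'',z') \right)$$ on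 $I^W(\Gamma)$, whose identity $\delta$ is given by $\delta(z,z') = 1$ if $z = z'$ and $\delta(z,z') = 0$ otherwise. -/

import Mathlib

open scoped Polynomial TensorProduct

noncomputable section

/-! ### Posets, rank functions, lower Eulerian posets -/

section Posets

variable {B : Type*} [PartialOrder B]

/-- `ρ` is a rank function: `ρ z' = ρ z + 1` whenever `z'` covers `z`. -/
def IsRankFunction (ρ : B → ℤ) : Prop :=
  ∀ z z' : B, z ⋖ z' → ρ z' = ρ z + 1

/-- A lower Eulerian poset: it is finite, has a unique minimal element and admits a rank function
`ρ` such that `∑_{z ≤ z'' ≤ z'} (-1)^{ρ z''} = 0` for all `z < z'`. -/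
def IsLowerEulerian (B : Type*) [PartialOrder B] : Prop :=
  Finite B ∧ (∃! b : B, IsMin b) ∧
  ∃ ρ : B → ℤ, IsRankFunction ρ ∧
    ∀ z z' : B, z < z' → ∑ᶠ x : Set.Icc z z', ((ρ x).negOnePow : ℤ) = 0

open Classical in
/-- A choice of rank function on a poset that admits one (and `0` on any other poset). -/
def rankFunction (B : Type*) [PartialOrder B] : B → ℤ :=
  if h : ∃ ρ : B → ℤ, IsRankFunction ρ then h.choose else 0

/-- The natural weak rank function `(z, z') ↦ ρ z' - ρ z` (for `z ≤ z'`) of a poset with rank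
function `ρ`. On a finite poset the difference does not depend on the choice of `ρ`, and it is
nonnegative. -/
def naturalRank (z z' : B) : ℕ :=
  (rankFunction B z' - rankFunction B z).toNat

/-- Weak rank functions. Only the values `r z z'` with `z ≤ z'` matter. -/
structure IsWeakRankFunction (r : B → B → ℕ) : Prop where
  pos : ∀ z z' : B, z < z' → 0 < r z z'
  add : ∀ z z'' z' : B, z ≤ z'' → z'' ≤ z' → r z z' = r z z'' + r z'' z'

end Posets

/-! ### The non-Hausdorff mapping cylinder -/

section Cylinder

/-- The underlying set of the non-Hausdorff mapping cylinder of an order-preserving map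
`σ : X → Y`: the disjoint union of `X` and `Y`. -/
inductive MappingCylinder {X Y : Type*} [PartialOrder X] [PartialOrder Y] (σ : X →o Y)
  | inX (x : X) : MappingCylinder σ
  | inY (y : Y) : MappingCylinder σ

namespace MappingCylinder

variable {X Y : Type*} [PartialOrder X] [PartialOrder Y] {σ : X →o Y}

/-- The order of the mapping cylinder: the orders of `X` and of `Y`, and `x ≤ y` if and only if
`σ x ≤ y` for `x ∈ X` and `y ∈ Y`. -/
protected def le : MappingCylinder σ → MappingCylinder σ → Prop
  | inX x, inX x' => x ≤ x'
  | inX x, inY y => σ x ≤ y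
  | inY _, inX _ => False
  | inY y, inY y' => y ≤ y'

instance : PartialOrder (MappingCylinder σ) where
  le := MappingCylinder.le
  le_refl z := by cases z <;> exact le_refl _
  le_trans a b c hab hbc := by
    cases a <;> cases b <;> cases c
    · exact le_trans (α := X) hab hbc
    · exact le_trans (σ.monotone hab) hbc
    · exact hbc.elim
    · exact le_trans (α := Y) hab hbc
    · exact hab.elim
    · exact hab.elim
    · exact hbc.elim
    · exact le_trans (α := Y) hab hbc
  le_antisymm a b hab hba := by
    cases a <;> cases b
    · exact congrArg inX (le_antisymm (α := X) hab hba)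
    · exact hba.elim
    · exact hab.elim
    · exact congrArg inY (le_antisymm (α := Y) hab hba)

instance [Finite X] [Finite Y] : Finite (MappingCylinder σ) :=
  Finite.of_injective
    (fun z : MappingCylinder σ => match z with
      | inX x => (Sum.inl x : X ⊕ Y)
      | inY y => Sum.inr y)
    (by rintro (a | a) (b | b) h <;> simp_all)

/-- Compatible automorphisms of `X` and `Y` induce an automorphism of the mapping cylinder. -/
def mapIso (e : X ≃o X) (f : Y ≃o Y) (h : ∀ x, σ (e x) = f (σ x)) :
    MappingCylinder σ ≃o MappingCylinder σ where
  toFun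
    | inX x => inX (e x)
    | inY y => inY (f y)
  invFun
    | inX x => inX (e.symm x)
    | inY y => inY (f.symm y)
  left_inv z := by cases z <;> simp
  right_inv z := by cases z <;> simp
  map_rel_iff' {a b} := by
    cases a <;> cases b
    · exact e.le_iff_le
    · change σ (e _) ≤ f _ ↔ σ _ ≤ _
      rw [h]
      exact f.le_iff_le
    · exact Iff.rfl
    · exact f.le_iff_le

/-- Actions of `W` on `X` and on `Y` for which `σ` is equivariant induce an action of `W` on the
mapping cylinder. -/
def action {W : Type*} [Group W] (aX : W →* (X ≃o X)) (aY : W →* (Y ≃o Y))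
    (h : ∀ w x, σ (aX w x) = aY w (σ x)) :
    W →* (MappingCylinder σ ≃o MappingCylinder σ) where
  toFun w := mapIso (aX w) (aY w) (h w)
  map_one' := by
    ext z
    cases z <;> simp [mapIso]
  map_mul' w w' := by
    ext z
    cases z <;> simp [mapIso, RelIso.mul_apply]

end MappingCylinder

end Cylinder

/-! ### The representation ring, realized as the ring of virtual characters -/

section RepresentationRing

/-- The complex representation ring `R(G)`, realized as the ring of virtual characters of `G`:
the subring of the ring of functions `G → ℂ` generated by the characters of the
finite-dimensional complex representations of `G` (up to isomorphism, these act on `ℂⁿ`). Sums and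
products of characters are the characters of direct sums and tensor products, so the elements are
the differences of two characters. The class `[V]` of a representation is its character. -/
def RepRing (G : Type*) [Group G] : Subring (G → ℂ) :=
  Subring.closure {χ | ∃ (n : ℕ) (ρ : Representation ℂ G (Fin n → ℂ)), χ = ρ.character}

variable {G H : Type*} [Group G] [Group H]

theorem character_mem_repRing {V : Type*} [AddCommGroup V] [Module ℂ V] [FiniteDimensional ℂ V]
    (ρ : Representation ℂ G V) : ρ.character ∈ RepRing G := by
  apply Subring.subset_closure
  let e : V ≃ₗ[ℂ] (Fin (Module.finrank ℂ V) → ℂ) := (Module.finBasis ℂ V).equivFun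
  refine ⟨Module.finrank ℂ V, (e.conjRingEquiv : _ →* _).comp ρ, ?_⟩
  funext g
  exact (LinearMap.trace_conj' (ρ g) e).symm

/-- The class `[V] ∈ R(G)` of a finite-dimensional complex representation `V` of `G`. -/
def repClass {V : Type*} [AddCommGroup V] [Module ℂ V] [FiniteDimensional ℂ V]
    (ρ : Representation ℂ G V) : RepRing G :=
  ⟨ρ.character, character_mem_repRing ρ⟩

/-- Pullback `Λ_η : R(H) → R(G)` of representations along a homomorphism `η : G → H`. -/
def pullback (η : G →* H) : RepRing H →+* RepRing G :=
  ((RingHom.pi fun g => Pi.evalRingHom (fun _ : H => ℂ) (η g)).comp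
    (RepRing H).subtype).codRestrict (RepRing G) <| by
      rintro ⟨χ, hχ⟩
      have key : RepRing H ≤ (RepRing G).comap
          (RingHom.pi fun g => Pi.evalRingHom (fun _ : H => ℂ) (η g)) := by
        refine Subring.closure_le.2 ?_
        rintro _ ⟨n, ρ, rfl⟩
        exact Subring.subset_closure ⟨n, ρ.comp η, rfl⟩
      exact key hχ

/-- Evaluation `ev_g : R(G) → ℂ` of class functions at `g`. -/
def ev (g : G) : RepRing G →+* ℂ :=
  (Pi.evalRingHom (fun _ : G => ℂ) g).comp (RepRing G).subtype

/-- Evaluation `ev_g : R(G)[t] → ℂ[t]`, applied coefficientwise. -/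
def evPoly (g : G) : (RepRing G)[X] →+* ℂ[X] :=
  Polynomial.mapRingHom (ev g)

/-- The inclusion of `R(G)[t]` in the polynomials over the ring of all functions `G → ℂ`. -/
def toFunctions : (RepRing G)[X] →+* (G → ℂ)[X] :=
  Polynomial.mapRingHom (RepRing G).subtype

/-- Induction of a class function from a subgroup `H` to a subgroup `K ⊇ H` of a finite group:
`(Ind f)(k) = |H|⁻¹ ∑_{x ∈ K, x⁻¹ k x ∈ H} f (x⁻¹ k x)`. On characters this is
the induction of representations. -/
def induce {H K : Subgroup G} (f : H → ℂ) : K → ℂ := by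
  classical
  exact fun k => (Nat.card H : ℂ)⁻¹ *
    ∑ᶠ x : K, if h : (x : G)⁻¹ * k * x ∈ H then f ⟨(x : G)⁻¹ * k * x, h⟩ else 0

/-- Induction applied coefficientwise. -/
def inducePoly {H : Subgroup G} (K : Subgroup G) (p : (H → ℂ)[X]) : (K → ℂ)[X] :=
  p.sum fun n f => Polynomial.monomial n (induce (K := K) f)

/-- The complexification of a real representation. -/
def complexify {V : Type*} [AddCommGroup V] [Module ℝ V] (ρ : Representation ℝ G V) :
    Representation ℂ G (ℂ ⊗[ℝ] V) where
  toFun g := (ρ g).baseChange ℂ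
  map_one' := by rw [map_one]; exact LinearMap.baseChange_one ℝ V
  map_mul' g h := by rw [map_mul]; exact LinearMap.baseChange_mul (ρ g) (ρ h)

/-- The `m`-th exterior power of a representation. -/
def exteriorRep {V : Type*} [AddCommGroup V] [Module ℂ V] (ρ : Representation ℂ G V) (m : ℕ) :
    Representation ℂ G (⋀[ℂ]^m V) where
  toFun g := exteriorPower.map m (ρ g)
  map_one' := by rw [map_one]; exact exteriorPower.map_id (R := ℂ) (M := V)
  map_mul' g h := by
    rw [map_mul, Module.End.mul_eq_comp, exteriorPower.map_comp, Module.End.mul_eq_comp]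

/-- For a complex representation `ρ` on `V`, the polynomial
`det(tI - ρ) = t^{dim V} ∑_m (-1)^m [⋀^m V] t^{-m} ∈ R(G)[t]`. -/
def detPoly {V : Type*} [AddCommGroup V] [Module ℂ V] [FiniteDimensional ℂ V]
    (ρ : Representation ℂ G V) : (RepRing G)[X] :=
  ∑ m ∈ Finset.range (Module.finrank ℂ V + 1),
    Polynomial.C ((-1) ^ m * repClass (exteriorRep ρ m)) *
      Polynomial.X ^ (Module.finrank ℂ V - m)

end RepresentationRing

/-! ### Equivariant incidence algebras -/

section EquivariantIncidence

variable {W : Type*} [Group W] {B : Type*} [PartialOrder B]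

/-- The stabilizer `W_z` of `z` for an action `a` of `W` on the poset `B`. -/
def stab (a : W →* (B ≃o B)) (z : B) : Subgroup W where
  carrier := {w | a w z = z}
  one_mem' := by simp
  mul_mem' {v w} hv hw := by
    simp only [Set.mem_ofPred_eq] at *
    rw [map_mul, RelIso.mul_apply, hw, hv]
  inv_mem' {w} hw := by
    simp only [Set.mem_ofPred_eq] at *
    have h : a w⁻¹ (a w z) = z := by rw [← RelIso.mul_apply, ← map_mul]; simp
    rwa [hw] at h

/-- `W_{z,z'} = W_z ∩ W_{z'}`. -/
def stab₂ (a : W →* (B ≃o B)) (z z' : B) : Subgroup W := stab a z ⊓ stab a z'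

/-- `W_{z,z'',z'} = W_z ∩ W_{z''} ∩ W_{z'}`. -/
def stab₃ (a : W →* (B ≃o B)) (z z'' z' : B) : Subgroup W := stab a z ⊓ stab a z'' ⊓ stab a z'

theorem stab₃_le_left (a : W →* (B ≃o B)) (z z'' z' : B) : stab₃ a z z'' z' ≤ stab₂ a z z'' :=
  fun _ h => h.1

theorem stab₃_le_right (a : W →* (B ≃o B)) (z z'' z' : B) : stab₃ a z z'' z' ≤ stab₂ a z'' z' :=
  fun _ h => ⟨h.1.2, h.2⟩

theorem conj_mem_stab (a : W →* (B ≃o B)) (w : W) {v : W} {z : B} (hv : v ∈ stab a z) :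
    w * v * w⁻¹ ∈ stab a (a w z) := by
  change a (w * v * w⁻¹) (a w z) = a w z
  have hv' : a v z = z := hv
  rw [← RelIso.mul_apply, ← map_mul, inv_mul_cancel_right, map_mul, RelIso.mul_apply, hv']

/-- The isomorphism `η^w_{z,z'} : W_{z,z'} → W_{w z, w z'}`, `v ↦ w v w⁻¹`. -/
def conjStab (a : W →* (B ≃o B)) (w : W) (z z' : B) :
    stab₂ a z z' →* stab₂ a (a w z) (a w z') where
  toFun v := ⟨w * v * w⁻¹, conj_mem_stab a w v.2.1, conj_mem_stab a w v.2.2⟩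
  map_one' := by ext; simp
  map_mul' u v := by ext; simp

/-- The fixed poset `B^w`. -/
abbrev FixedPoset (a : W →* (B ≃o B)) (w : W) : Type _ := {z : B // a w z = z}

/-- The action of `W` on the lower Eulerian poset `B` is Eulerian: every fixed poset `B^w` is
lower Eulerian. -/
def IsEulerianAction (a : W →* (B ≃o B)) : Prop :=
  IsLowerEulerian B ∧ ∀ w : W, IsLowerEulerian (FixedPoset a w)

/-- `W`-invariant weak rank functions. -/
def IsInvariantRank (a : W →* (B ≃o B)) (r : B → B → ℕ) : Prop :=
  ∀ (w : W) (z z' : B), z ≤ z' → r (a w z) (a w z') = r z z'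

/-- Functions assigning to every interval `[z,z']` an element of `R(W_{z,z'})[t]`. -/
abbrev IncidenceFamily (a : W →* (B ≃o B)) : Type _ :=
  ∀ z z' : B, z ≤ z' → (RepRing (stab₂ a z z'))[X]

/-- `p` belongs to the equivariant incidence algebra `I^W(B)`:
`p(z,z') = Λ_{η^w_{z,z'}} (p(w z, w z'))`. -/
def IsEquivariant (a : W →* (B ≃o B)) (p : IncidenceFamily a) : Prop :=
  ∀ (w : W) (z z' : B) (h : z ≤ z'),
    p z z' h = (p (a w z) (a w z') ((a w).monotone h)).map (pullback (conjStab a w z z'))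

/-- `p` belongs to `𝓘^W(B)`: `p ∈ I^W(B)` and `deg p(z,z') ≤ r(z,z')`. -/
def IsBounded (a : W →* (B ≃o B)) (r : B → B → ℕ) (p : IncidenceFamily a) : Prop :=
  IsEquivariant a p ∧ ∀ (z z' : B) (h : z ≤ z'), (p z z' h).degree ≤ r z z'

/-- `p` takes the value `1` on all intervals `[z,z]`; together with `p ∈ I^W(B)` this says that
`p ∈ U^W(B)`. -/
def IsUnital (a : W →* (B ≃o B)) (p : IncidenceFamily a) : Prop :=
  ∀ z : B, p z z le_rfl = 1

/-- `p^rev(z,z';t) = t^{r(z,z')} p(z,z';t⁻¹)`. -/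
def revFamily (a : W →* (B ≃o B)) (r : B → B → ℕ) (p : IncidenceFamily a) : IncidenceFamily a :=
  fun z z' h => (p z z' h).reflect (r z z')

/-- The product of `I^W(B)`:
`(p q)(z,z') = ∑_{z ≤ z'' ≤ z'} |W_{z,z'',z'}| / |W_{z,z'}| Ind (Res p(z,z'') · Res q(z'',z'))`.
Because of the fractions it is computed in polynomials over all functions `W_{z,z'} → ℂ`. -/
def convolution (a : W →* (B ≃o B)) (p q : IncidenceFamily a) (z z' : B) :
    (stab₂ a z z' → ℂ)[X] :=
  ∑ᶠ x : Set.Icc z z',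
    ((Nat.card (stab₃ a z x z') : ℂ) / (Nat.card (stab₂ a z z') : ℂ)) •
      inducePoly (stab₂ a z z') (toFunctions
        ((p z x x.2.1).map (pullback (Subgroup.inclusion (stab₃_le_left a z x z'))) *
          (q x z' x.2.2).map (pullback (Subgroup.inclusion (stab₃_le_right a z x z')))))

open Classical in
/-- The identity `δ` of `I^W(B)`. -/
def deltaFamily (a : W →* (B ≃o B)) : IncidenceFamily a :=
  fun z z' _ => if z = z' then 1 else 0

/-- `κ` is an equivariant `B`-kernel with respect to the `W`-invariant weak rank function `r`:
`κ ∈ 𝓘^W(B) ∩ U^W(B)` and `κ⁻¹ = κ^rev`. -/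
structure IsEquivariantKernel (a : W →* (B ≃o B)) (r : B → B → ℕ) (κ : IncidenceFamily a) :
    Prop where
  bounded : IsBounded a r κ
  unital : IsUnital a κ
  mul_rev : ∀ (z z' : B) (h : z ≤ z'),
    convolution a κ (revFamily a r κ) z z' = toFunctions (deltaFamily a z z' h)
  rev_mul : ∀ (z z' : B) (h : z ≤ z'),
    convolution a (revFamily a r κ) κ z z' = toFunctions (deltaFamily a z z' h)

/-- `ev_w(p)(z,z') ∈ ℂ[t]` for an interval `[z,z']` of `B^w`. -/
def evFamily (a : W →* (B ≃o B)) (w : W) (p : IncidenceFamily a) (z z' : FixedPoset a w)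
    (h : z ≤ z') : ℂ[X] :=
  evPoly (⟨w, z.2, z'.2⟩ : stab₂ a z.1 z'.1) (p z.1 z'.1 h)

/-- `p` is multiplicative: `ev_w(p(z,z')) = ev_w(p(z,z'')) ev_w(p(z'',z'))` for all `w` and all
`z ≤ z'' ≤ z'` in `B^w`. -/
def IsMultiplicative (a : W →* (B ≃o B)) (p : IncidenceFamily a) : Prop :=
  ∀ (w : W) (z z'' z' : FixedPoset a w) (h : z ≤ z'') (h' : z'' ≤ z'),
    evFamily a w p z z' (h.trans h') = evFamily a w p z z'' h * evFamily a w p z'' z' h'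

/-- `p` is rank alternating: `p^rev = p̂`, where `p̂` is determined by
`ev_w(p̂)(z,z') = (-1)^{ρ(z,z')} ev_w(p)(z,z')` for all `w` and all `z ≤ z'` in `B^w`, with `ρ`
the natural weak rank function of `B^w`. -/
def IsRankAlternating (a : W →* (B ≃o B)) (r : B → B → ℕ) (p : IncidenceFamily a) : Prop :=
  ∀ (w : W) (z z' : FixedPoset a w) (h : z ≤ z'),
    evFamily a w (revFamily a r p) z z' h = (-1) ^ naturalRank z z' * evFamily a w p z z' h

end EquivariantIncidence

/-! ### Fans and their morphisms -/

section Fans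

/-- A fan in a real vector space: a nonempty finite collection of polyhedral cones with minimal
face the origin, closed under passing to faces, any two of which meet in a common face. -/
structure Fan (V : Type*) [AddCommGroup V] [Module ℝ V] where
  cones : Set (PointedCone ℝ V)
  finite : cones.Finite
  nonempty : cones.Nonempty
  /-- Every cone is an intersection of finitely many half-spaces. -/
  polyhedral : ∀ C ∈ cones, ∃ s : Finset (Module.Dual ℝ V), ∀ v, v ∈ C ↔ ∀ f ∈ s, 0 ≤ f v
  /-- No cone contains a line. -/
  pointed : ∀ C ∈ cones, ∀ v ∈ C, -v ∈ C → v = 0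
  face_mem : ∀ C ∈ cones, ∀ F : PointedCone ℝ V, F.IsFaceOf C → F ∈ cones
  inter_face : ∀ C ∈ cones, ∀ D ∈ cones, (C ⊓ D).IsFaceOf C ∧ (C ⊓ D).IsFaceOf D

namespace Fan

variable {V V' : Type*} [AddCommGroup V] [Module ℝ V] [AddCommGroup V'] [Module ℝ V']

/-- The face poset of a fan: its cones, ordered by inclusion. -/
abbrev Face (S : Fan V) : Type _ := {C : PointedCone ℝ V // C ∈ S.cones}

instance (S : Fan V) : Finite S.Face := S.finite

/-- The support of a fan: the union of its cones. -/
def support (S : Fan V) : Set V := {v | ∃ C ∈ S.cones, v ∈ C}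

theorem inter_mem (S : Fan V) {C D : PointedCone ℝ V} (hC : C ∈ S.cones) (hD : D ∈ S.cones) :
    C ⊓ D ∈ S.cones :=
  S.face_mem C hC _ (S.inter_face C hC D hD).1

/-- `φ` defines a morphism of fans: every cone is mapped into some cone. -/
def IsMorphism (S' : Fan V') (S : Fan V) (φ : V' →ₗ[ℝ] V) : Prop :=
  ∀ C' ∈ S'.cones, ∃ C ∈ S.cones, C'.map φ ≤ C

theorem exists_least {S' : Fan V'} {S : Fan V} {φ : V' →ₗ[ℝ] V} (h : IsMorphism S' S φ)
    (C' : S'.Face) : ∃ C : S.Face, IsLeast {C : S.Face | C'.1.map φ ≤ C.1} C := by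
  obtain ⟨C₀, hC₀, hle⟩ := h C'.1 C'.2
  obtain ⟨C, hC⟩ := (Set.toFinite {C : S.Face | C'.1.map φ ≤ C.1}).exists_minimal
    ⟨⟨C₀, hC₀⟩, hle⟩
  refine ⟨C, hC.prop, fun D hD => ?_⟩
  have hmem : (⟨C.1 ⊓ D.1, S.inter_mem C.2 D.2⟩ : S.Face) ∈
      {C : S.Face | C'.1.map φ ≤ C.1} :=
    show C'.1.map φ ≤ C.1 ⊓ D.1 from le_inf hC.prop hD
  have h1 : C ≤ ⟨C.1 ⊓ D.1, S.inter_mem C.2 D.2⟩ :=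
    hC.le_of_le hmem (show C.1 ⊓ D.1 ≤ C.1 from inf_le_left)
  exact h1.trans (show C.1 ⊓ D.1 ≤ D.1 from inf_le_right)

/-- The induced map of face posets: `σ(C')` is the smallest cone containing `φ(C')`. -/
def faceMap {S' : Fan V'} {S : Fan V} {φ : V' →ₗ[ℝ] V} (h : IsMorphism S' S φ) :
    S'.Face →o S.Face where
  toFun C' := (exists_least h C').choose
  monotone' C' D' hle :=
    (exists_least h C').choose_spec.2
      (le_trans (Submodule.map_mono hle) (exists_least h D').choose_spec.1)

theorem faceMap_le_iff {S' : Fan V'} {S : Fan V} {φ : V' →ₗ[ℝ] V} (h : IsMorphism S' S φ)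
    (C' : S'.Face) (C : S.Face) : faceMap h C' ≤ C ↔ C'.1.map φ ≤ C.1 :=
  ⟨fun hle => le_trans (exists_least h C').choose_spec.1 hle,
    fun hle => (exists_least h C').choose_spec.2 hle⟩

/-- The morphism of fans defined by `φ` is proper: `φ⁻¹(|S|) = |S'|`. -/
def IsProper (S' : Fan V') (S : Fan V) (φ : V' →ₗ[ℝ] V) : Prop :=
  φ ⁻¹' S.support = S'.support

variable {W : Type*} [Group W]

/-- The fan is invariant under a linear representation of `W`. -/
def IsInvariant (S : Fan V) (ψ : Representation ℝ W V) : Prop :=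
  ∀ (w : W), ∀ C ∈ S.cones, C.map (ψ w) ∈ S.cones

theorem map_map_rep (ψ : Representation ℝ W V) (v w : W) (C : PointedCone ℝ V) :
    (C.map (ψ w)).map (ψ v) = C.map (ψ (v * w)) := by
  rw [PointedCone.map_map, map_mul]; rfl

theorem map_rep_one (ψ : Representation ℝ W V) (C : PointedCone ℝ V) : C.map (ψ 1) = C := by
  rw [map_one]; exact PointedCone.map_id C

/-- The action of `W` on the face poset of an invariant fan, `w · C = ψ(w)(C)`. -/
def faceAction {S : Fan V} {ψ : Representation ℝ W V} (hS : S.IsInvariant ψ) :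
    W →* (S.Face ≃o S.Face) where
  toFun w :=
    { toFun := fun C => ⟨C.1.map (ψ w), hS w C.1 C.2⟩
      invFun := fun C => ⟨C.1.map (ψ w⁻¹), hS w⁻¹ C.1 C.2⟩
      left_inv := fun C => Subtype.ext (by simp only [map_map_rep, inv_mul_cancel, map_rep_one])
      right_inv := fun C => Subtype.ext (by simp only [map_map_rep, mul_inv_cancel, map_rep_one])
      map_rel_iff' := by
        intro C D
        refine ⟨fun h => ?_, fun h => Submodule.map_mono h⟩
        have h' : (C.1.map (ψ w)).map (ψ w⁻¹) ≤ (D.1.map (ψ w)).map (ψ w⁻¹) := Submodule.map_mono h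
        simp only [map_map_rep, inv_mul_cancel, map_rep_one] at h'
        exact h' }
  map_one' := by
    refine RelIso.ext fun C => ?_
    exact Subtype.ext (map_rep_one ψ C.1)
  map_mul' v w := by
    refine RelIso.ext fun C => ?_
    exact Subtype.ext (map_map_rep ψ v w C.1).symm

end Fan

/-- A `W`-equivariant morphism of `W`-invariant fans: fans `source` in `V'` and `target` in `V`,
linear representations `ψ'` on `V'` and `ψ` on `V` preserving them, and a `W`-equivariant linear
map `φ : V' → V` that induces a morphism of fans. -/
structure EquivariantFanMorphism (W V' V : Type*) [Group W] [AddCommGroup V'] [Module ℝ V']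
    [AddCommGroup V] [Module ℝ V] where
  source : Fan V'
  target : Fan V
  φ : V' →ₗ[ℝ] V
  ψ' : Representation ℝ W V'
  ψ : Representation ℝ W V
  isMorphism : source.IsMorphism target φ
  source_invariant : source.IsInvariant ψ'
  target_invariant : target.IsInvariant ψ
  equivariant : ∀ (w : W) (v : V'), φ (ψ' w v) = ψ w (φ v)

namespace EquivariantFanMorphism

open Fan

variable {W V' V : Type*} [Group W] [AddCommGroup V'] [Module ℝ V'] [AddCommGroup V] [Module ℝ V]
  (D : EquivariantFanMorphism W V' V)

/-- The induced map `σ` from `X` (the face poset of the source) to `Y` (the face poset of the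
target). -/
def σ : D.source.Face →o D.target.Face := faceMap D.isMorphism

/-- The mapping cylinder `Γ` of `σ`. -/
abbrev Γ : Type _ := MappingCylinder D.σ

theorem map_comm (w : W) (C : PointedCone ℝ V') :
    (C.map (D.ψ' w)).map D.φ = (C.map D.φ).map (D.ψ w) := by
  rw [PointedCone.map_map, PointedCone.map_map]
  congr 1
  exact LinearMap.ext (D.equivariant w)

theorem σ_equivariant (w : W) (x : D.source.Face) :
    D.σ (faceAction D.source_invariant w x) = faceAction D.target_invariant w (D.σ x) := by
  refine eq_of_forall_ge_iff fun C => ?_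
  have h1 : D.σ (faceAction D.source_invariant w x) ≤ C ↔
      (x.1.map D.φ).map (D.ψ w) ≤ C.1 := by
    rw [← D.map_comm]
    exact faceMap_le_iff D.isMorphism _ C
  have h2 : x.1.map D.φ ≤ (D.σ x).1 := (faceMap_le_iff D.isMorphism x (D.σ x)).1 le_rfl
  rw [h1]
  constructor
  · intro h
    rw [← OrderIso.le_symm_apply]
    refine (faceMap_le_iff D.isMorphism x _).2 ?_
    have h3 : ((x.1.map D.φ).map (D.ψ w)).map (D.ψ w⁻¹) ≤ C.1.map (D.ψ w⁻¹) := Submodule.map_mono h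
    rw [map_map_rep, inv_mul_cancel, map_rep_one] at h3
    exact h3
  · intro h
    exact le_trans (Submodule.map_mono h2) h

/-- The action of `W` on `Γ` induced by its actions on the two fans. -/
def action : W →* (D.Γ ≃o D.Γ) :=
  MappingCylinder.action (faceAction D.source_invariant) (faceAction D.target_invariant)
    D.σ_equivariant

/-- The cone `C'_z` in `V'` attached to `z ∈ Γ`: the cone `C'` itself if `z = C' ∈ X`, and
`φ⁻¹(C)` if `z = C ∈ Y`. -/
def cone : D.Γ → PointedCone ℝ V'
  | .inX C' => C'.1
  | .inY C => C.1.comap D.φ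

/-- The linear span `V'_z` of `C'_z`. -/
def coneSpan (z : D.Γ) : Submodule ℝ V' := Submodule.span ℝ (D.cone z : Set V')

theorem mem_cone_action (w : W) (z : D.Γ) {v : V'} (hv : v ∈ D.cone z) :
    D.ψ' w v ∈ D.cone (D.action w z) := by
  cases z with
  | inX C => exact ⟨v, hv, rfl⟩
  | inY C => exact ⟨D.φ v, hv, (D.equivariant w v).symm⟩

theorem coneSpan_le_comap (w : W) (z : D.Γ) (hw : D.action w z = z) :
    D.coneSpan z ≤ (D.coneSpan z).comap (D.ψ' w) := by
  refine Submodule.span_le.2 fun v hv => Submodule.subset_span ?_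
  have h := D.mem_cone_action w z hv
  rwa [hw] at h

/-- The representation of `W_{z,z'}` on `V'_{z'}`. -/
def spanRep (z z' : D.Γ) : Representation ℝ (stab₂ D.action z z') (D.coneSpan z') :=
  Representation.subrepresentation (D.ψ'.comp (stab₂ D.action z z').subtype) (D.coneSpan z')
    fun w => D.coneSpan_le_comap w.1 z' w.2.2

/-- The representation `ψ_{z,z'}` of `W_{z,z'}` on `V'_{z'} / V'_z` (for `z ≤ z'`). -/
def quotRep (z z' : D.Γ) : Representation ℝ (stab₂ D.action z z')
    (D.coneSpan z' ⧸ (D.coneSpan z).submoduleOf (D.coneSpan z')) :=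
  (D.spanRep z z').quotient ((D.coneSpan z).submoduleOf (D.coneSpan z'))
    fun w v hv => by
      have h : (v : V') ∈ D.coneSpan z := hv
      exact D.coneSpan_le_comap w.1 z w.2.1 h

/-- The element `κ_Γ`: `κ_Γ(z,z') = (t - 1) det(tI - ψ_{z,z'})` if `z ∈ X` and `z' ∈ Y`, and
`κ_Γ(z,z') = det(tI - ψ_{z,z'})` otherwise, where the real representation `ψ_{z,z'}` is viewed as a
complex representation. -/
def kappa [FiniteDimensional ℝ V'] : IncidenceFamily D.action := fun z z' _ =>
  match z, z' with
  | .inX x, .inY y => (Polynomial.X - 1) * detPoly (complexify (D.quotRep (.inX x) (.inY y)))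
  | z, z' => detPoly (complexify (D.quotRep z z'))

end EquivariantFanMorphism

end Fans

end

noncomputable section

/-! ### The Euler characteristic of unions of cells of a central hyperplane arrangement -/

section EulerCharacteristic

open Filter Topology

variable {U : Type*} [AddCommGroup U] [Module ℝ U]

/-! Two facts carry the theorem: an Euler characteristic identity for cones, and a factorization of
the values of `kappa`.

Attach to `z` the cone `C'_z` in `V'` and the rank `dim C'_z`, plus one if `z ∈ Y`. The relative
interiors of the cones of `X` tile `|Σ'|`, and so do those of the preimages of the cones of `Y`,
because `φ` is surjective and proper. Let `p` be a relative interior point of `C'_z`. The elements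
of `[z, z']` of one kind (from `X`, or from `Y`) are the ones below `z'` of that kind whose cone
contains `p`, provided that `z` is not in `Y` when the kind is `X`. The directions from `p` into
their relative interiors tile the directions into `C'_{z'}`. An open cone of dimension `d` has
compactly supported Euler characteristic `(-1)^d`, so the alternating sum over one kind is a number
depending only on `p` and `C'_{z'}`, and it is `0` unless `p` is relatively interior to `C'_{z'}`
(`sum_neg_one_pow_finrank_span`). If both kinds occur in the interval, the extra one in the rank
makes the two sums cancel; if only one kind occurs and `z < z'`, then `p` is not interior and the
sum is `0`. That the rank grows by one along covers comes from the same tilings. The argument needs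
only the axioms `IsConeSystem`. These survive intersection with the fixed space of `w`, by summing
over the powers of `w` (`IsConeSystem.fixed`), so every `Γ^w` is covered as well.

For the kernel, let `P_z` be the characteristic polynomial of `w` on `V'_z`, times `t - 1` if `z ∈
Y`. Then `ev_w κ(z,z') = P_{z'} / P_z` (`evFamily_kappa_mul`), which gives equivariance, degrees and
multiplicativity. The eigenvalues of `w` are roots of unity closed under conjugation, so reversing
`P_z` multiplies it by `(-1)` to the rank of `z` in `Γ^w`; this is rank alternation. Finally, a
product in `I^W(Γ)` evaluated at `k` is an ordinary convolution over `Γ^k` (`coeff_convolution`).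
For `κ` and `κ^rev` its terms are signs times the single polynomial `ev_k κ(z,z')`, and the signs
sum to `0` on proper intervals because `Γ^k` is Eulerian. -/

theorem eventually_sign_add_mul (a b : ℝ) : ∀ᶠ ε in 𝓝[>] (0 : ℝ),
    SignType.sign (a + ε * b) = if a = 0 then SignType.sign b else SignType.sign a := by
  rcases eq_or_ne a 0 with rfl | ha
  · filter_upwards [self_mem_nhdsWithin] with ε hε
    have hε : 0 < ε := hε
    rw [zero_add, if_pos rfl, sign_mul, sign_pos hε, one_mul]
  · have hc : Tendsto (fun ε : ℝ => a + ε * b) (𝓝[>] 0) (𝓝 a) := by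
      have : Tendsto (fun ε : ℝ => a + ε * b) (𝓝 0) (𝓝 (a + 0 * b)) :=
        (continuous_const.add (continuous_id.mul continuous_const)).tendsto 0
      simpa using this.mono_left nhdsWithin_le_nhds
    rw [if_neg ha]
    rcases lt_or_gt_of_ne ha with h | h
    · filter_upwards [hc.eventually (gt_mem_nhds h)] with ε hε
      rw [sign_neg hε, sign_neg h]
    · filter_upwards [hc.eventually (lt_mem_nhds h)] with ε hε
      rw [sign_pos hε, sign_pos h]

open Classical in
/-- The sign vector of a point with respect to a finite set of linear functionals, extended by `0`
to all functionals. -/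
def signVector (H : Finset (Module.Dual ℝ U)) (x : U) (h : Module.Dual ℝ U) : SignType :=
  if h ∈ H then SignType.sign (h x) else 0

theorem signVector_eq_iff {H : Finset (Module.Dual ℝ U)} {x y : U} :
    signVector H x = signVector H y ↔ ∀ h ∈ H, SignType.sign (h x) = SignType.sign (h y) := by
  constructor
  · intro e h hh
    simpa [signVector, hh] using congrFun e h
  · intro e
    funext h
    by_cases hh : h ∈ H
    · simp [signVector, hh, e h hh]
    · simp [signVector, hh]

theorem finite_range_signVector (H : Finset (Module.Dual ℝ U)) :
    (Set.range (signVector H)).Finite := by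
  classical
  refine Set.Finite.of_finite_image (f := fun τ (h : H) => τ h.1) (Set.toFinite _) ?_
  rintro _ ⟨x, rfl⟩ _ ⟨y, rfl⟩ e
  refine signVector_eq_iff.2 fun h hh => ?_
  simpa [signVector, hh] using congrFun e ⟨h, hh⟩

/-- The intersection of the kernels of the functionals in `H` at which the sign vector vanishes:
the linear span of the corresponding cell. -/
def signFlat (H : Finset (Module.Dual ℝ U)) (τ : Module.Dual ℝ U → SignType) : Submodule ℝ U where
  carrier := {u | ∀ h ∈ H, τ h = 0 → h u = 0}
  zero_mem' h _ _ := map_zero h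
  add_mem' {a b} ha hb h hh h0 := by rw [map_add, ha h hh h0, hb h hh h0, add_zero]
  smul_mem' c a ha h hh h0 := by rw [map_smul, ha h hh h0, smul_zero]

theorem mem_signFlat {H : Finset (Module.Dual ℝ U)} {τ : Module.Dual ℝ U → SignType} {u : U} :
    u ∈ signFlat H τ ↔ ∀ h ∈ H, τ h = 0 → h u = 0 := Iff.rfl

theorem mem_signFlat_signVector {H : Finset (Module.Dual ℝ U)} {x u : U} :
    u ∈ signFlat H (signVector H x) ↔ ∀ h ∈ H, h x = 0 → h u = 0 := by
  refine forall₂_congr fun h hh => ?_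
  simp [signVector, hh]

/-- A set is saturated if it is a union of cells. -/
def IsSaturated (H : Finset (Module.Dual ℝ U)) (A : Set U) : Prop :=
  ∀ x ∈ A, ∀ y, signVector H x = signVector H y → y ∈ A

theorem IsSaturated.mono {H H' : Finset (Module.Dual ℝ U)} {A : Set U} (hA : IsSaturated H A)
    (h : H ⊆ H') : IsSaturated H' A := fun x hx y hxy =>
  hA x hx y (signVector_eq_iff.2 fun f hf => signVector_eq_iff.1 hxy f (h hf))

theorem finite_signVector_image (H : Finset (Module.Dual ℝ U)) (A : Set U) :
    (signVector H '' A).Finite :=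
  (finite_range_signVector H).subset (Set.image_subset_range _ _)

/-- The alternating number of cells in a saturated set. -/
def cellCount (H : Finset (Module.Dual ℝ U)) (A : Set U) : ℤ :=
  ∑ τ ∈ (finite_signVector_image H A).toFinset, (-1) ^ Module.finrank ℝ (signFlat H τ)

/-- A cell is open in its span: nonzero values keep their sign under a small move, and the vanishing
functionals also vanish at `u`. -/
theorem exists_pos_signVector_add_smul {H : Finset (Module.Dual ℝ U)} {x u : U}
    (hu : u ∈ signFlat H (signVector H x)) :
    ∃ ε : ℝ, 0 < ε ∧ signVector H (x + ε • u) = signVector H x := by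
  have h1 : ∀ᶠ ε in 𝓝[>] (0 : ℝ), ∀ h ∈ H,
      SignType.sign (h (x + ε • u)) = SignType.sign (h x) := by
    rw [eventually_all_finset]
    intro h hh
    filter_upwards [eventually_sign_add_mul (h x) (h u)] with ε hε
    rw [map_add, map_smul, smul_eq_mul, hε]
    split_ifs with h0
    · rw [mem_signFlat_signVector.1 hu h hh h0, h0]
    · rfl
  obtain ⟨ε, h2, h3⟩ := (h1.and self_mem_nhdsWithin).exists
  exact ⟨ε, h3, signVector_eq_iff.2 h2⟩

theorem sign_combo {a b : ℝ} {c d : ℝ} (hc : 0 < c) (hd : 0 < d)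
    (h : SignType.sign a = SignType.sign b) : SignType.sign (c * a + d * b) = SignType.sign a := by
  rcases lt_trichotomy a 0 with ha | rfl | ha
  · rw [sign_neg ha] at h ⊢
    have hb : b < 0 := sign_eq_neg_one_iff.1 h.symm
    exact sign_neg (by nlinarith)
  · rw [sign_zero] at h ⊢
    have hb : b = 0 := sign_eq_zero_iff.1 h.symm
    simp [hb]
  · rw [sign_pos ha] at h ⊢
    have hb : 0 < b := sign_eq_one_iff.1 h.symm
    exact sign_pos (by positivity)

theorem finrank_inf_ker [FiniteDimensional ℝ U] (L : Submodule ℝ U) (g : Module.Dual ℝ U) {u : U}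
    (hu : u ∈ L) (hg : g u ≠ 0) :
    Module.finrank ℝ L = Module.finrank ℝ (L ⊓ LinearMap.ker g : Submodule ℝ U) + 1 := by
  have h1 := LinearMap.finrank_range_add_finrank_ker (g.comp L.subtype)
  have h2 : LinearMap.range (g.comp L.subtype) = ⊤ := by
    refine LinearMap.range_eq_top.2 fun r => ⟨(r / g u) • ⟨u, hu⟩, ?_⟩
    simp [hg]
  have h3 : Module.finrank ℝ (LinearMap.ker (g.comp L.subtype)) =
      Module.finrank ℝ (L ⊓ LinearMap.ker g : Submodule ℝ U) := by
    rw [LinearMap.ker_comp, ← Submodule.map_comap_subtype]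
    exact (Submodule.finrank_map_subtype_eq _ _).symm
  rw [h2, h3, finrank_top, Module.finrank_self] at h1
  lia

open Classical in
theorem signVector_insert {H : Finset (Module.Dual ℝ U)} {g : Module.Dual ℝ U} (x : U) :
    signVector (insert g H) x = Function.update (signVector H x) g (SignType.sign (g x)) := by
  funext h
  by_cases hg : h = g
  · subst hg; simp [signVector]
  · simp [signVector, hg]

open Classical in
theorem signFlat_insert {H : Finset (Module.Dual ℝ U)} {g : Module.Dual ℝ U} (hg : g ∉ H)
    (τ : Module.Dual ℝ U → SignType) (a : SignType) :
    signFlat (insert g H) (Function.update τ g a) =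
      if a = 0 then signFlat H τ ⊓ LinearMap.ker g else signFlat H τ := by
  have key : ∀ h ∈ H, Function.update τ g a h = τ h := fun h hh =>
    Function.update_of_ne (by rintro rfl; exact hg hh) _ _
  ext u
  split_ifs with ha
  · subst ha
    simp only [mem_signFlat, Finset.forall_mem_insert, Function.update_self, forall_const,
      Submodule.mem_inf, LinearMap.mem_ker]
    rw [and_comm]
    exact and_congr_left' (forall₂_congr fun h hh => by rw [key h hh])
  · simp only [mem_signFlat, Finset.forall_mem_insert, Function.update_self, ha, false_implies,
      true_and]
    exact forall₂_congr fun h hh => by rw [key h hh]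

open Classical in
-- A new hyperplane leaves a cell of dimension `d` whole or cuts it into pieces of dimensions `d`,
-- `d - 1`, `d`, and `(-1)^d + (-1)^(d-1) + (-1)^d = (-1)^d`.
theorem cellCount_insert [FiniteDimensional ℝ U] {H : Finset (Module.Dual ℝ U)} {A : Set U}
    (hA : IsSaturated H A) (g : Module.Dual ℝ U) : cellCount (insert g H) A = cellCount H A := by
  by_cases hg : g ∈ H
  · rw [Finset.insert_eq_of_mem hg]
  unfold cellCount
  have hH0 : ∀ x, signVector H x g = 0 := fun x => by simp [signVector, hg]
  have hmaps : ∀ τ ∈ (finite_signVector_image (insert g H) A).toFinset,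
      Function.update τ g 0 ∈ (finite_signVector_image H A).toFinset := by
    intro τ hτ
    obtain ⟨x, hx, rfl⟩ := (Set.Finite.mem_toFinset _).1 hτ
    refine (Set.Finite.mem_toFinset _).2 ⟨x, hx, ?_⟩
    rw [signVector_insert, Function.update_idem]
    exact (Function.update_eq_self_iff.2 (hH0 x).symm).symm
  rw [← Finset.sum_fiberwise_of_maps_to hmaps]
  refine Finset.sum_congr rfl fun τ hτ => ?_
  obtain ⟨x, hx, rfl⟩ := (Set.Finite.mem_toFinset _).1 hτ
  set τ := signVector H x with hτdef
  -- The pieces of the cell `τ` correspond to the signs that `g` takes on it.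
  have hfib : (finite_signVector_image (insert g H) A).toFinset.filter
      (fun τ' => Function.update τ' g 0 = τ) =
      (Finset.univ.filter fun a : SignType =>
        ∃ y, signVector H y = τ ∧ SignType.sign (g y) = a).image
        (Function.update τ g) := by
    ext τ'
    simp only [Finset.mem_filter, Set.Finite.mem_toFinset, Finset.mem_image, Finset.mem_univ,
      true_and]
    constructor
    · rintro ⟨⟨y, hy, rfl⟩, h2⟩
      have hy2 : signVector H y = τ := by
        rw [← h2, signVector_insert, Function.update_idem]
        exact (Function.update_eq_self_iff.2 (hH0 y).symm).symm
      exact ⟨_, ⟨y, hy2, rfl⟩, by rw [← hy2, signVector_insert]⟩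
    · rintro ⟨_, ⟨y, hy, rfl⟩, rfl⟩
      refine ⟨⟨y, hA x hx y hy.symm, by rw [signVector_insert, hy]⟩, ?_⟩
      rw [Function.update_idem]
      exact Function.update_eq_self_iff.2 (hH0 x).symm
  rw [hfib, Finset.sum_image fun a _ b _ e => Function.update_injective τ g e]
  have hrank : ∀ a, Module.finrank ℝ (signFlat (insert g H) (Function.update τ g a)) =
      if a = 0 then Module.finrank ℝ (signFlat H τ ⊓ LinearMap.ker g : Submodule ℝ U)
        else Module.finrank ℝ (signFlat H τ) := by
    intro a
    rw [signFlat_insert hg, apply_ite (fun L : Submodule ℝ U => Module.finrank ℝ L)]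
  simp_rw [hrank]
  have hsub : ∀ y, signVector H y = τ → y ∈ signFlat H τ := fun y hy => by
    rw [← hy]; exact mem_signFlat_signVector.2 fun h _ h0 => h0
  by_cases hL : ∀ u ∈ signFlat H τ, g u = 0
  · have hT : (Finset.univ.filter fun a : SignType =>
        ∃ y, signVector H y = τ ∧ SignType.sign (g y) = a) = {0} := by
      ext a
      simp only [Finset.mem_filter, Finset.mem_univ, true_and, Finset.mem_singleton]
      constructor
      · rintro ⟨y, hy, rfl⟩
        rw [hL y (hsub y hy), sign_zero]
      · rintro rfl
        exact ⟨x, rfl, by rw [hL x (hsub x rfl), sign_zero]⟩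
    rw [hT, Finset.sum_singleton, if_pos rfl, inf_eq_left.2 fun u hu => hL u hu]
  push Not at hL
  obtain ⟨u, hu, hgu⟩ := hL
  by_cases hz : ∃ y, signVector H y = τ ∧ g y = 0
  · obtain ⟨y, hy, hgy⟩ := hz
    have hT : (Finset.univ.filter fun a : SignType =>
        ∃ y, signVector H y = τ ∧ SignType.sign (g y) = a) = Finset.univ := by
      refine Finset.filter_true_of_mem fun a _ => ?_
      -- The scaling by `a / g u` makes `g` take the value `ε * a` at the moved point, which has
      -- sign `a`; so all three signs occur.
      have hmem : (((a : ℝ) * (g u)⁻¹) • u) ∈ signFlat H (signVector H y) := by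
        rw [hy]; exact Submodule.smul_mem _ _ hu
      obtain ⟨ε, hε, h1⟩ := exists_pos_signVector_add_smul hmem
      refine ⟨_, h1.trans hy, ?_⟩
      rw [map_add, hgy, map_smul, map_smul, zero_add, smul_eq_mul, smul_eq_mul,
        inv_mul_cancel_right₀ hgu, sign_mul, sign_pos hε, one_mul]
      rcases a.trichotomy with rfl | rfl | rfl <;> simp
    rw [hT, finrank_inf_ker _ g hu hgu]
    have : (Finset.univ : Finset SignType) = {0, -1, 1} := rfl
    rw [this, Finset.sum_insert (by decide), Finset.sum_insert (by decide), Finset.sum_singleton]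
    simp only [if_true, if_neg (show (-1 : SignType) ≠ 0 by decide),
      if_neg (show (1 : SignType) ≠ 0 by decide)]
    ring
  · push Not at hz
    have hT : (Finset.univ.filter fun a : SignType =>
        ∃ y, signVector H y = τ ∧ SignType.sign (g y) = a) = {SignType.sign (g x)} := by
      ext a
      simp only [Finset.mem_filter, Finset.mem_univ, true_and, Finset.mem_singleton]
      constructor
      · rintro ⟨y, hy, rfl⟩
        have key : ∀ y z, signVector H y = τ → signVector H z = τ → 0 < g y → 0 < g z := by
          intro y z hy hz' hgy
          by_contra hgz
          have hgz : g z < 0 := lt_of_le_of_ne (not_lt.1 hgz) (hz z hz')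
          -- The cell is convex, so if `g` had both signs on it, this positive combination would be
          -- a zero of `g` in the cell.
          refine hz ((-g z) • y + (g y) • z) ?_ ?_
          · rw [← hy]
            refine signVector_eq_iff.2 fun h hh => ?_
            rw [map_add, map_smul, map_smul, smul_eq_mul, smul_eq_mul]
            exact sign_combo (by linarith) hgy (signVector_eq_iff.1 (hy.trans hz'.symm) h hh)
          · rw [map_add, map_smul, map_smul, smul_eq_mul, smul_eq_mul]; ring
        rcases lt_or_gt_of_ne (hz y hy) with h | h
        · have : g x < 0 := lt_of_le_of_ne (not_lt.1 fun h' => h.not_gt (key x y rfl hy h'))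
            (hz x rfl)
          rw [sign_neg h, sign_neg this]
        · rw [sign_pos h, sign_pos (key y x hy rfl h)]
      · rintro rfl
        exact ⟨x, rfl, rfl⟩
    rw [hT, Finset.sum_singleton, if_neg (sign_ne_zero.2 (hz x rfl))]

theorem cellCount_of_subset [FiniteDimensional ℝ U] {H H' : Finset (Module.Dual ℝ U)} {A : Set U}
    (hA : IsSaturated H A) (h : H ⊆ H') : cellCount H' A = cellCount H A := by
  classical
  have key : ∀ K : Finset (Module.Dual ℝ U), cellCount (K ∪ H) A = cellCount H A := by
    intro K
    induction K using Finset.induction_on with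
    | empty => rw [Finset.empty_union]
    | insert g K _ ih =>
      rw [Finset.insert_union, cellCount_insert (hA.mono Finset.subset_union_right), ih]
  rw [← key H', Finset.union_eq_left.2 h]

/-- `A` is a union of cells of some central hyperplane arrangement and has (compactly supported)
Euler characteristic `e`. -/
def HasEulerChar (A : Set U) (e : ℤ) : Prop := ∃ H, IsSaturated H A ∧ cellCount H A = e

/-- Both counts agree with the count for the union of the two arrangements. -/
theorem HasEulerChar.unique [FiniteDimensional ℝ U] {A : Set U} {e e' : ℤ} (h : HasEulerChar A e)
    (h' : HasEulerChar A e') : e = e' := by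
  classical
  obtain ⟨H, hH, rfl⟩ := h
  obtain ⟨H', hH', rfl⟩ := h'
  rw [← cellCount_of_subset hH (Finset.subset_union_left (s₂ := H')),
    ← cellCount_of_subset hH' (Finset.subset_union_right (s₁ := H))]

theorem hasEulerChar_empty : HasEulerChar (∅ : Set U) 0 :=
  ⟨∅, fun _ h => h.elim, by simp [cellCount]⟩

theorem HasEulerChar.union [FiniteDimensional ℝ U] {A A' : Set U} {e e' : ℤ}
    (h : HasEulerChar A e) (h' : HasEulerChar A' e') (hd : Disjoint A A') :
    HasEulerChar (A ∪ A') (e + e') := by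
  classical
  obtain ⟨H, hH, rfl⟩ := h
  obtain ⟨H', hH', rfl⟩ := h'
  have hA := hH.mono (Finset.subset_union_left (s₂ := H'))
  have hA' := hH'.mono (Finset.subset_union_right (s₁ := H))
  refine ⟨H ∪ H', ?_, ?_⟩
  · rintro x (hx | hx) y hxy
    · exact Or.inl (hA x hx y hxy)
    · exact Or.inr (hA' x hx y hxy)
  · rw [← cellCount_of_subset hH (Finset.subset_union_left (s₂ := H')),
      ← cellCount_of_subset hH' (Finset.subset_union_right (s₁ := H))]
    unfold cellCount
    rw [← Finset.sum_union]
    · refine Finset.sum_congr ?_ fun _ _ => rfl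
      ext τ
      simp [Set.image_union]
    · rw [Finset.disjoint_left]
      intro τ h1 h2
      obtain ⟨x, hx, rfl⟩ := (Set.Finite.mem_toFinset _).1 h1
      obtain ⟨y, hy, hxy⟩ := (Set.Finite.mem_toFinset _).1 h2
      exact Set.disjoint_left.1 hd (hA x hx y hxy.symm) hy

theorem HasEulerChar.biUnion [FiniteDimensional ℝ U] {ι : Type*} (S : Finset ι) (A : ι → Set U)
    (e : ι → ℤ) (h : ∀ i ∈ S, HasEulerChar (A i) (e i))
    (hd : ∀ i ∈ S, ∀ j ∈ S, ∀ x, x ∈ A i → x ∈ A j → i = j) :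
    HasEulerChar (⋃ i ∈ S, A i) (∑ i ∈ S, e i) := by
  classical
  induction S using Finset.induction_on with
  | empty => simpa using hasEulerChar_empty
  | insert a S ha ih =>
    rw [Finset.sum_insert ha, Finset.set_biUnion_insert]
    refine (h a (Finset.mem_insert_self a S)).union
      (ih (fun i hi => h i (Finset.mem_insert_of_mem hi)) fun i hi j hj =>
        hd i (Finset.mem_insert_of_mem hi) j (Finset.mem_insert_of_mem hj)) ?_
    rw [Set.disjoint_left]
    intro x hx hx'
    obtain ⟨i, hi, hxi⟩ := Set.mem_iUnion₂.1 hx'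
    obtain rfl := hd a (Finset.mem_insert_self a S) i (Finset.mem_insert_of_mem hi) x hx hxi
    exact ha hi

theorem hasEulerChar_cell (H : Finset (Module.Dual ℝ U)) (x : U) :
    HasEulerChar {y | signVector H y = signVector H x}
      ((-1) ^ Module.finrank ℝ (signFlat H (signVector H x))) := by
  refine ⟨H, fun y hy z hyz => hyz.symm.trans hy, ?_⟩
  unfold cellCount
  rw [Finset.sum_eq_single (signVector H x)]
  · intro τ hτ hne
    obtain ⟨y, hy, rfl⟩ := (Set.Finite.mem_toFinset _).1 hτ
    exact (hne hy).elim
  · intro h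
    exact (h ((Set.Finite.mem_toFinset _).2 ⟨x, rfl, rfl⟩)).elim

/-- The open half-strip over a cell `c` in a direction `v` that is transverse to `c`. -/
theorem hasEulerChar_strip [FiniteDimensional ℝ U] (H : Finset (Module.Dual ℝ U)) (x v : U)
    (f : Module.Dual ℝ U) (hf : f ∈ H) (hfx : f x = 0) (hfv : 0 < f v) :
    HasEulerChar {y | ∃ t : ℝ, 0 < t ∧ signVector H (y - t • v) = signVector H x}
      (-(-1) ^ Module.finrank ℝ (signFlat H (signVector H x))) := by
  classical
  -- `p` is the projection onto the kernel of `f` along `v`.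
  set p : U →ₗ[ℝ] U := LinearMap.id - (f.smulRight ((f v)⁻¹ • v)) with hp
  have hpy : ∀ y, p y = y - (f y * (f v)⁻¹) • v := fun y => by simp [hp, mul_smul]
  have hfp : ∀ y, f (p y) = 0 := fun y => by
    rw [hpy, map_sub, map_smul, smul_eq_mul, inv_mul_cancel_right₀ hfv.ne', sub_self]
  -- For this arrangement the half-strip is a single cell, the one through `x + v`; its span is that
  -- of the old cell plus the line of `v`.
  set H₂ : Finset (Module.Dual ℝ U) := insert f (H.image fun h => h.comp p) with hH₂
  have hset : {y | ∃ t : ℝ, 0 < t ∧ signVector H (y - t • v) = signVector H x} =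
      {y | signVector H₂ y = signVector H₂ (x + v)} := by
    have hpx : p (x + v) = x := by
      rw [hpy, map_add, hfx, zero_add, mul_inv_cancel₀ hfv.ne', one_smul, add_sub_cancel_right]
    ext y
    simp only [Set.mem_ofPred_eq, signVector_eq_iff, hH₂, Finset.forall_mem_insert,
      Finset.forall_mem_image, LinearMap.comp_apply, hpx]
    rw [map_add, hfx, zero_add, sign_pos hfv, sign_eq_one_iff]
    constructor
    · rintro ⟨t, ht, h⟩
      have h1 := h f hf
      rw [hfx, sign_zero, sign_eq_zero_iff, map_sub, map_smul, smul_eq_mul, sub_eq_zero] at h1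
      refine ⟨by rw [h1]; positivity, fun g hg => ?_⟩
      rw [hpy, h1, mul_inv_cancel_right₀ hfv.ne']
      exact h g hg
    · rintro ⟨h1, h2⟩
      exact ⟨f y * (f v)⁻¹, by positivity, fun g hg => by rw [← hpy]; exact h2 hg⟩
  have hfin : Module.finrank ℝ (signFlat H₂ (signVector H₂ (x + v))) =
      Module.finrank ℝ (signFlat H (signVector H x)) + 1 := by
    have hpx : p (x + v) = x := by
      rw [hpy, map_add, hfx, zero_add, mul_inv_cancel₀ hfv.ne', one_smul, add_sub_cancel_right]
    have hmem : ∀ u, u ∈ signFlat H₂ (signVector H₂ (x + v)) ↔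
        p u ∈ signFlat H (signVector H x) := by
      intro u
      simp only [mem_signFlat_signVector, hH₂, Finset.forall_mem_insert,
        Finset.forall_mem_image, LinearMap.comp_apply, hpx]
      rw [map_add, hfx, zero_add]
      simp [hfv.ne']
    have hv : v ∈ signFlat H₂ (signVector H₂ (x + v)) := by
      rw [hmem, hpy, mul_inv_cancel₀ hfv.ne', one_smul, sub_self]
      exact Submodule.zero_mem _
    rw [finrank_inf_ker _ f hv hfv.ne']
    suffices h : signFlat H₂ (signVector H₂ (x + v)) ⊓ LinearMap.ker f =
        signFlat H (signVector H x) by rw [h]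
    ext u
    rw [Submodule.mem_inf, hmem, LinearMap.mem_ker]
    constructor
    · rintro ⟨h1, h2⟩
      rwa [hpy, h2, zero_mul, zero_smul, sub_zero] at h1
    · intro h
      have h2 : f u = 0 := mem_signFlat_signVector.1 h f hf hfx
      refine ⟨?_, h2⟩
      rwa [hpy, h2, zero_mul, zero_smul, sub_zero]
  have h := hasEulerChar_cell H₂ (x + v)
  rw [← hset, hfin, pow_succ, mul_neg_one] at h
  exact h

/-- A closed polyhedral cone that is not a linear subspace has Euler characteristic `0`. -/
theorem hasEulerChar_closed_cone [FiniteDimensional ℝ U] (H : Finset (Module.Dual ℝ U)) (v : U)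
    (hv : ∀ f ∈ H, 0 ≤ f v) (hv' : ∃ f ∈ H, f v ≠ 0) :
    HasEulerChar {x | ∀ f ∈ H, 0 ≤ f x} 0 := by
  classical
  -- `B` is the part of the boundary through which a line in direction `v` enters the cone. Every
  -- point of the cone is `y + t • v` for unique `y ∈ B` and `t ≥ 0`, so the cone is a disjoint
  -- union of half-closed strips over the cells of `B`.
  set B : Set U := {x | (∀ f ∈ H, 0 ≤ f x) ∧ ∃ f ∈ H, f x = 0 ∧ 0 < f v} with hB
  have hBsat : IsSaturated H B := by
    rintro x ⟨h1, f, hf, h2, h3⟩ y hxy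
    rw [signVector_eq_iff] at hxy
    refine ⟨fun g hg => ?_, f, hf, ?_, h3⟩
    · rw [← sign_nonneg_iff, ← hxy g hg, sign_nonneg_iff]
      exact h1 g hg
    · rw [← sign_eq_zero_iff, ← hxy f hf, h2, sign_zero]
  set S := (finite_signVector_image H B).toFinset
  have hdecomp : {x | ∀ f ∈ H, 0 ≤ f x} =
      ⋃ τ ∈ S, {y | ∃ t : ℝ, 0 ≤ t ∧ signVector H (y - t • v) = τ} := by
    ext x
    simp only [Set.mem_ofPred_eq, Set.mem_iUnion, exists_prop]
    constructor
    · intro hx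
      obtain ⟨f₁, hf₁, hne⟩ := hv'
      have hpos : (H.filter fun f => 0 < f v).Nonempty :=
        ⟨f₁, Finset.mem_filter.2 ⟨hf₁, lt_of_le_of_ne (hv f₁ hf₁) hne.symm⟩⟩
      -- The minimal ratio is the largest `t` for which `x - t • v` stays in the cone; the
      -- minimizing `f` vanishes there.
      obtain ⟨f, hf, hmin⟩ := Finset.exists_min_image _ (fun f => f x / f v) hpos
      obtain ⟨hfH, hfv⟩ := Finset.mem_filter.1 hf
      refine ⟨_, (Set.Finite.mem_toFinset _).2 ⟨x - (f x / f v) • v, ⟨fun g hg => ?_, f, hfH, ?_,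
        hfv⟩, rfl⟩, f x / f v, div_nonneg (hx f hfH) hfv.le, rfl⟩
      · rw [map_sub, map_smul, smul_eq_mul, sub_nonneg]
        rcases (hv g hg).eq_or_lt with h0 | h0
        · rw [← h0, mul_zero]; exact hx g hg
        · exact (le_div_iff₀ h0).1 (hmin g (Finset.mem_filter.2 ⟨hg, h0⟩))
      · rw [map_sub, map_smul, smul_eq_mul, div_mul_cancel₀ _ hfv.ne', sub_self]
    · rintro ⟨τ, hτ, t, ht, h⟩ f hf
      obtain ⟨y, hy, rfl⟩ := (Set.Finite.mem_toFinset _).1 hτ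
      have h1 := (hBsat y hy _ h.symm).1 f hf
      rw [map_sub, map_smul, smul_eq_mul] at h1
      nlinarith [mul_nonneg ht (hv f hf)]
  rw [hdecomp, show (0 : ℤ) = ∑ τ ∈ S, 0 from Finset.sum_const_zero.symm]
  refine HasEulerChar.biUnion (U := U) S _ _ ?_ ?_
  · intro τ hτ
    obtain ⟨x, ⟨hx, f, hf, hfx, hfv⟩, rfl⟩ := (Set.Finite.mem_toFinset _).1 hτ
    have hset : {y | ∃ t : ℝ, 0 ≤ t ∧ signVector H (y - t • v) = signVector H x} =
        {y | signVector H y = signVector H x} ∪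
          {y | ∃ t : ℝ, 0 < t ∧ signVector H (y - t • v) = signVector H x} := by
      ext y
      simp only [Set.mem_ofPred_eq, Set.mem_union]
      constructor
      · rintro ⟨t, ht, h⟩
        rcases ht.eq_or_lt with rfl | ht
        · exact Or.inl (by simpa using h)
        · exact Or.inr ⟨t, ht, h⟩
      · rintro (h | ⟨t, ht, h⟩)
        · exact ⟨0, le_rfl, by simpa using h⟩
        · exact ⟨t, ht.le, h⟩
    -- The cell and the open strip over it have opposite Euler characteristics.
    rw [hset, ← add_neg_cancel ((-1 : ℤ) ^ Module.finrank ℝ (signFlat H (signVector H x)))]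
    refine (hasEulerChar_cell H x).union (hasEulerChar_strip H x v f hf hfx hfv) ?_
    · rw [Set.disjoint_left]
      rintro y hy ⟨t, ht, h⟩
      have h1 := signVector_eq_iff.1 hy f hf
      have h2 := signVector_eq_iff.1 h f hf
      rw [hfx, sign_zero, sign_eq_zero_iff] at h1 h2
      rw [map_sub, map_smul, smul_eq_mul, h1, zero_sub, neg_eq_zero] at h2
      exact (mul_pos ht hfv).ne' h2
  · have key : ∀ y ∈ B, ∀ y' ∈ B, ∀ t : ℝ, 0 ≤ t → y' = y + t • v → t = 0 := by
      rintro y hy y' ⟨-, f, hf, h1, h2⟩ t ht rfl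
      rw [map_add, map_smul, smul_eq_mul] at h1
      have h3 := hy.1 f hf
      have h4 : t * f v = 0 := le_antisymm (by linarith) (mul_nonneg ht h2.le)
      exact (mul_eq_zero.1 h4).resolve_right h2.ne'
    rintro τ hτ τ' hτ' x ⟨t, ht, h⟩ ⟨t', ht', h'⟩
    obtain ⟨y, hy, rfl⟩ := (Set.Finite.mem_toFinset _).1 hτ
    obtain ⟨y', hy', rfl⟩ := (Set.Finite.mem_toFinset _).1 hτ'
    have hyB := hBsat y hy _ h.symm
    have hyB' := hBsat y' hy' _ h'.symm
    have htt : t = t' := by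
      rcases le_total t t' with hle | hle
      · have := key _ hyB' _ hyB (t' - t) (by linarith) (by rw [sub_smul]; abel)
        linarith
      · have := key _ hyB _ hyB' (t - t') (by linarith) (by rw [sub_smul]; abel)
        linarith
    rw [← h, ← h', htt]

end EulerCharacteristic

/-! ### Polyhedral cones and their relative interiors -/

section Cones

open Filter Topology

variable {U : Type*} [AddCommGroup U] [Module ℝ U]

/-- A cone is polyhedral if it is a finite intersection of closed half-spaces. -/
def IsPolyhedral (C : PointedCone ℝ U) : Prop :=
  ∃ s : Finset (Module.Dual ℝ U), ∀ v, v ∈ C ↔ ∀ f ∈ s, 0 ≤ f v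

/-- The relative interior of a convex cone. -/
def relInterior (C : PointedCone ℝ U) : Set U :=
  {x | x ∈ C ∧ ∀ y ∈ C, ∃ ε : ℝ, 0 < ε ∧ x - ε • y ∈ C}

theorem sub_smul_mem_of_le {C : PointedCone ℝ U} {x y : U} (hx : x ∈ C) {ε δ : ℝ} (hε : 0 < ε)
    (h : x - ε • y ∈ C) (hδ : 0 ≤ δ) (hle : δ ≤ ε) : x - δ • y ∈ C := by
  have h1 : x - δ • y = (1 - δ / ε) • x + (δ / ε) • (x - ε • y) := by
    rw [smul_sub, smul_smul, div_mul_cancel₀ _ hε.ne', sub_smul, one_smul]; abel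
  rw [h1]
  exact C.add_mem (PointedCone.smul_mem _ (sub_nonneg.2 ((div_le_one hε).2 hle)) hx)
    (PointedCone.smul_mem _ (by positivity) h)

theorem add_mem_relInterior {C : PointedCone ℝ U} {x y : U} (hx : x ∈ C) (hy : y ∈ relInterior C) :
    x + y ∈ relInterior C := by
  refine ⟨C.add_mem hx hy.1, fun z hz => ?_⟩
  obtain ⟨ε, hε, h⟩ := hy.2 z hz
  exact ⟨ε, hε, by rw [add_sub_assoc]; exact C.add_mem hx h⟩

theorem smul_mem_relInterior {C : PointedCone ℝ U} {x : U} (hx : x ∈ relInterior C) {t : ℝ}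
    (ht : 0 < t) : t • x ∈ relInterior C := by
  refine ⟨PointedCone.smul_mem _ ht.le hx.1, fun z hz => ?_⟩
  obtain ⟨ε, hε, h⟩ := hx.2 z hz
  exact ⟨t * ε, by positivity, by
    rw [mul_smul, ← smul_sub]; exact PointedCone.smul_mem _ ht.le h⟩

/-- The smallest face of a cone that contains a given point. -/
def minimalFace (C : PointedCone ℝ U) (x : U) (hx : x ∈ C) : PointedCone ℝ U where
  carrier := {y | y ∈ C ∧ ∃ ε : ℝ, 0 < ε ∧ x - ε • y ∈ C}
  zero_mem' := ⟨C.zero_mem, 1, one_pos, by simpa using hx⟩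
  add_mem' := by
    rintro a b ⟨ha, ε, hε, h⟩ ⟨hb, δ, hδ, h'⟩
    refine ⟨C.add_mem ha hb, min ε δ / 2, by positivity, ?_⟩
    have h1 := sub_smul_mem_of_le hx hε h (le_min hε.le hδ.le) (min_le_left _ _)
    have h2 := sub_smul_mem_of_le hx hδ h' (le_min hε.le hδ.le) (min_le_right _ _)
    have h3 : x - (min ε δ / 2) • (a + b) =
        (1 / 2 : ℝ) • (x - min ε δ • a) + (1 / 2 : ℝ) • (x - min ε δ • b) := by
      module
    rw [h3]
    exact C.add_mem (PointedCone.smul_mem _ (by norm_num) h1)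
      (PointedCone.smul_mem _ (by norm_num) h2)
  smul_mem' := by
    rintro ⟨c, hc⟩ a ⟨ha, ε, hε, h⟩
    -- Dividing by `c + 1` instead of `c` covers `c = 0`.
    refine ⟨PointedCone.smul_mem _ hc ha, ε / (c + 1), by positivity, ?_⟩
    have hle : ε / (c + 1) * c ≤ ε := by
      rw [div_mul_eq_mul_div, div_le_iff₀ (by positivity)]
      nlinarith
    have h1 := sub_smul_mem_of_le hx hε h (by positivity) hle
    rwa [mul_smul] at h1

theorem minimalFace_isFaceOf (C : PointedCone ℝ U) (x : U) (hx : x ∈ C) :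
    (minimalFace C x hx).IsFaceOf C := by
  refine ⟨fun y hy => hy.1, fun {y z a} hy hz ha h => ⟨hy, ?_⟩⟩
  obtain ⟨-, ε, hε, h⟩ := h
  refine ⟨ε * a, by positivity, ?_⟩
  have h1 : x - (ε * a) • y = (x - ε • (a • y + z)) + ε • z := by module
  rw [h1]
  exact C.add_mem h (PointedCone.smul_mem _ hε.le hz)

theorem mem_relInterior_minimalFace (C : PointedCone ℝ U) (x : U) (hx : x ∈ C) :
    x ∈ relInterior (minimalFace C x hx) := by
  refine ⟨⟨hx, 1, one_pos, by simp⟩, ?_⟩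
  rintro y ⟨hy, ε, hε, h⟩
  refine ⟨ε / 2, by positivity,
    sub_smul_mem_of_le hx hε h (by positivity) (by linarith), 1 / 2, by norm_num, ?_⟩
  have h1 : x - (1 / 2 : ℝ) • (x - (ε / 2) • y) = (1 / 2 : ℝ) • x + (ε / 4) • y := by module
  rw [h1]
  exact C.add_mem (PointedCone.smul_mem _ (by norm_num) hx)
    (PointedCone.smul_mem _ (by positivity) hy)

/-- For any `y ∈ C`, the point `p` of the face is a sum of a positive multiple of `y` and an element
of `C`, which forces `y` into the face. -/
theorem eq_of_isFaceOf_of_mem_relInterior {F C : PointedCone ℝ U} (hF : F.IsFaceOf C) {p : U}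
    (hp : p ∈ relInterior C) (hpF : p ∈ F) : F = C := by
  refine le_antisymm hF.le fun y hy => ?_
  obtain ⟨ε, hε, h⟩ := hp.2 y hy
  refine hF.mem_of_smul_add_mem hy h hε ?_
  rwa [add_sub_cancel]

/-! ### Relative interiors and tangent directions of polyhedral cones -/

section Polyhedral

variable {C : PointedCone ℝ U} {s : Finset (Module.Dual ℝ U)}

theorem mem_relInterior_iff (hs : ∀ v, v ∈ C ↔ ∀ f ∈ s, 0 ≤ f v) {x : U} :
    x ∈ relInterior C ↔ x ∈ C ∧ ∀ f ∈ s, f x = 0 → ∀ y ∈ C, f y = 0 := by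
  constructor
  · rintro ⟨hx, h⟩
    refine ⟨hx, fun f hf h0 y hy => ?_⟩
    obtain ⟨ε, hε, h1⟩ := h y hy
    have h2 := (hs _).1 h1 f hf
    have h3 := (hs _).1 hy f hf
    rw [map_sub, h0, map_smul, smul_eq_mul] at h2
    nlinarith
  · rintro ⟨hx, h⟩
    refine ⟨hx, fun y hy => ?_⟩
    have h1 : ∀ᶠ ε in 𝓝[>] (0 : ℝ), ∀ f ∈ s, 0 ≤ f (x - ε • y) := by
      rw [eventually_all_finset]
      intro f hf
      filter_upwards [eventually_sign_add_mul (f x) (f (-y))] with ε hε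
      rw [sub_eq_add_neg, ← smul_neg, map_add, map_smul, smul_eq_mul, ← sign_nonneg_iff, hε]
      split_ifs with h0
      · rw [map_neg, h f hf h0 y hy, neg_zero, sign_zero]
      · exact sign_nonneg_iff.2 ((hs x).1 hx f hf)
    obtain ⟨ε, h2, h3⟩ := (h1.and self_mem_nhdsWithin).exists
    exact ⟨ε, h3, (hs _).2 h2⟩

/-- Pick for each functional a point of `C` where it is nonzero, if there is one, and add these
points. All values are nonnegative, so a functional vanishing at the sum vanishes at its own point.
-/
theorem relInterior_nonempty (hC : IsPolyhedral C) : (relInterior C).Nonempty := by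
  classical
  obtain ⟨s, hs⟩ := hC
  have h1 : ∀ f : Module.Dual ℝ U, ∃ y ∈ C, f y = 0 → ∀ z ∈ C, f z = 0 := by
    intro f
    by_cases h : ∃ y ∈ C, f y ≠ 0
    · obtain ⟨y, hy, h0⟩ := h
      exact ⟨y, hy, fun h => (h0 h).elim⟩
    · push Not at h
      exact ⟨0, C.zero_mem, fun _ => h⟩
  choose y hy hy0 using h1
  refine ⟨∑ f ∈ s, y f, (mem_relInterior_iff hs).2 ⟨C.sum_mem fun f _ => hy f, fun f hf h0 => ?_⟩⟩
  rw [map_sum, Finset.sum_eq_zero_iff_of_nonneg fun g _ => (hs _).1 (hy g) f hf] at h0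
  exact hy0 f (h0 f hf)

theorem eventually_add_smul_mem_iff (hs : ∀ v, v ∈ C ↔ ∀ f ∈ s, 0 ≤ f v) {p : U} (hp : p ∈ C)
    (y : U) : ∀ᶠ ε in 𝓝[>] (0 : ℝ), (p + ε • y ∈ C ↔ ∀ f ∈ s, f p = 0 → 0 ≤ f y) := by
  have h1 : ∀ᶠ ε in 𝓝[>] (0 : ℝ), ∀ f ∈ s, (0 ≤ f (p + ε • y) ↔ (f p = 0 → 0 ≤ f y)) := by
    rw [eventually_all_finset]
    intro f hf
    filter_upwards [eventually_sign_add_mul (f p) (f y)] with ε hε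
    rw [map_add, map_smul, smul_eq_mul, ← sign_nonneg_iff, hε]
    split_ifs with h0
    · simp [h0]
    · simpa [h0] using (hs p).1 hp f hf
  filter_upwards [h1] with ε hε
  rw [hs]
  exact forall₂_congr hε

theorem eventually_notMem (hs : ∀ v, v ∈ C ↔ ∀ f ∈ s, 0 ≤ f v) {p : U} (hp : p ∉ C)
    (y : U) : ∀ᶠ ε in 𝓝[>] (0 : ℝ), p + ε • y ∉ C := by
  rw [hs] at hp
  push Not at hp
  obtain ⟨f, hf, h0⟩ := hp
  filter_upwards [eventually_sign_add_mul (f p) (f y)] with ε hε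
  rw [if_neg h0.ne, sign_neg h0] at hε
  rw [hs]
  push Not
  refine ⟨f, hf, ?_⟩
  rw [map_add, map_smul, smul_eq_mul]
  exact sign_eq_neg_one_iff.1 hε

/-- The relative interior is thus a single cell of the arrangement `s`. -/
theorem mem_relInterior_iff_sign (hs : ∀ v, v ∈ C ↔ ∀ f ∈ s, 0 ≤ f v) {u : U}
    (hu : u ∈ relInterior C) {x : U} :
    x ∈ relInterior C ↔ ∀ f ∈ s, SignType.sign (f x) = SignType.sign (f u) := by
  have hu' := (mem_relInterior_iff hs).1 hu
  rw [mem_relInterior_iff hs]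
  constructor
  · rintro ⟨hx, h⟩ f hf
    by_cases h0 : f x = 0
    · rw [h0, h f hf h0 u hu.1]
    · have h1 : f u ≠ 0 := fun h1 => h0 (hu'.2 f hf h1 x hx)
      rw [sign_pos (lt_of_le_of_ne ((hs x).1 hx f hf) (Ne.symm h0)),
        sign_pos (lt_of_le_of_ne ((hs u).1 hu.1 f hf) (Ne.symm h1))]
  · intro h
    refine ⟨(hs x).2 fun f hf => ?_, fun f hf h0 => hu'.2 f hf ?_⟩
    · rw [← sign_nonneg_iff, h f hf, sign_nonneg_iff]
      exact (hs u).1 hu.1 f hf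
    · rw [← sign_eq_zero_iff, ← h f hf, h0, sign_zero]

open Classical in
/-- The functionals of `s` that vanish at `p`. -/
def activeSet (s : Finset (Module.Dual ℝ U)) (p : U) : Finset (Module.Dual ℝ U) :=
  s.filter fun f => f p = 0

theorem mem_activeSet {p : U} {f : Module.Dual ℝ U} : f ∈ activeSet s p ↔ f ∈ s ∧ f p = 0 := by
  simp [activeSet]

/-- A functional that is inactive at `p` is positive at `p`, hence also at the interior point `u`,
and it stays positive after a small move. Only the active ones constrain `y`. -/
theorem eventually_add_smul_mem_relInterior_iff (hs : ∀ v, v ∈ C ↔ ∀ f ∈ s, 0 ≤ f v) {p u : U}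
    (hp : p ∈ C) (hu : u ∈ relInterior C) (y : U) : ∀ᶠ ε in 𝓝[>] (0 : ℝ),
      (p + ε • y ∈ relInterior C ↔
        signVector (activeSet s p) y = signVector (activeSet s p) u) := by
  have h1 : ∀ᶠ ε in 𝓝[>] (0 : ℝ), ∀ f ∈ s,
      (SignType.sign (f (p + ε • y)) = SignType.sign (f u) ↔
        (f p = 0 → SignType.sign (f y) = SignType.sign (f u))) := by
    rw [eventually_all_finset]
    intro f hf
    filter_upwards [eventually_sign_add_mul (f p) (f y)] with ε hε
    rw [map_add, map_smul, smul_eq_mul, hε]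
    split_ifs with h0
    · simp [h0]
    · have h1 : f u ≠ 0 := fun h1 => h0 (((mem_relInterior_iff hs).1 hu).2 f hf h1 p hp)
      simp only [h0, false_implies, iff_true]
      rw [sign_pos (lt_of_le_of_ne ((hs p).1 hp f hf) (Ne.symm h0)),
        sign_pos (lt_of_le_of_ne ((hs u).1 hu.1 f hf) (Ne.symm h1))]
  filter_upwards [h1] with ε hε
  rw [mem_relInterior_iff_sign hs hu, signVector_eq_iff]
  simp only [mem_activeSet, and_imp]
  exact forall₂_congr hε

theorem mem_span_cone_iff (hs : ∀ v, v ∈ C ↔ ∀ f ∈ s, 0 ≤ f v) {x : U} :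
    x ∈ Submodule.span ℝ (C : Set U) ↔ ∀ f ∈ s, (∀ y ∈ C, f y = 0) → f x = 0 := by
  constructor
  · intro hx f hf h
    have : Submodule.span ℝ (C : Set U) ≤ LinearMap.ker f :=
      Submodule.span_le.2 fun y hy => h y hy
    exact this hx
  · intro h
    obtain ⟨p, hp⟩ := relInterior_nonempty ⟨s, hs⟩
    obtain ⟨ε, h1, hε⟩ :=
      ((eventually_add_smul_mem_iff hs hp.1 x).and self_mem_nhdsWithin).exists
    have hε : 0 < ε := hε
    have h2 : p + ε • x ∈ C := h1.2 fun f hf h0 =>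
      (h f hf (((mem_relInterior_iff hs).1 hp).2 f hf h0)).ge
    have h3 : x = ε⁻¹ • ((p + ε • x) - p) := by
      rw [add_sub_cancel_left, inv_smul_smul₀ hε.ne']
    rw [h3]
    exact Submodule.smul_mem _ _
      (Submodule.sub_mem _ (Submodule.subset_span h2) (Submodule.subset_span hp.1))

theorem mem_span_of_eventually {p y : U} (hp : p ∈ C)
    (h : ∀ᶠ ε in 𝓝[>] (0 : ℝ), p + ε • y ∈ C) : y ∈ Submodule.span ℝ (C : Set U) := by
  obtain ⟨ε, h1, hε⟩ := (h.and self_mem_nhdsWithin).exists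
  have hε : 0 < ε := hε
  have h3 : y = ε⁻¹ • ((p + ε • y) - p) := by
    rw [add_sub_cancel_left, inv_smul_smul₀ hε.ne']
  rw [h3]
  exact Submodule.smul_mem _ _
    (Submodule.sub_mem _ (Submodule.subset_span h1) (Submodule.subset_span hp))

theorem eventually_mem_of_mem_span (hC : IsPolyhedral C) {p y : U} (hp : p ∈ relInterior C)
    (hy : y ∈ Submodule.span ℝ (C : Set U)) : ∀ᶠ ε in 𝓝[>] (0 : ℝ), p + ε • y ∈ C := by
  obtain ⟨s, hs⟩ := hC
  filter_upwards [eventually_add_smul_mem_iff hs hp.1 y] with ε hε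
  exact hε.2 fun f hf h0 =>
    ((mem_span_cone_iff hs).1 hy f hf (((mem_relInterior_iff hs).1 hp).2 f hf h0)).ge

/-- The set of directions that point from `p` into `A`. -/
def tangentSet (p : U) (A : Set U) : Set U := {y | ∀ᶠ ε in 𝓝[>] (0 : ℝ), p + ε • y ∈ A}

theorem mem_tangentSet {p y : U} {A : Set U} :
    y ∈ tangentSet p A ↔ ∀ᶠ ε in 𝓝[>] (0 : ℝ), p + ε • y ∈ A := Iff.rfl

theorem mem_of_tangentSet_nonempty (hC : IsPolyhedral C) {p y : U}
    (h : y ∈ tangentSet p (C : Set U)) : p ∈ C := by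
  obtain ⟨s, hs⟩ := hC
  by_contra hp
  obtain ⟨ε, h1, h2⟩ := ((mem_tangentSet.1 h).and (eventually_notMem hs hp y)).exists
  exact h2 h1

theorem tangentSet_relInterior_subset (p : U) :
    tangentSet p (relInterior C) ⊆ tangentSet p (C : Set U) :=
  fun _ hy => (mem_tangentSet.1 hy).mono fun _ h => h.1

theorem mem_tangentSet_iff (hs : ∀ v, v ∈ C ↔ ∀ f ∈ s, 0 ≤ f v) {p y : U} (hp : p ∈ C) :
    y ∈ tangentSet p (C : Set U) ↔ ∀ f ∈ activeSet s p, 0 ≤ f y := by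
  have h := eventually_congr (eventually_add_smul_mem_iff hs hp y)
  refine h.trans (eventually_const.trans ?_)
  simp only [mem_activeSet, and_imp]

theorem mem_tangentSet_relInterior_iff (hs : ∀ v, v ∈ C ↔ ∀ f ∈ s, 0 ≤ f v) {p u y : U}
    (hp : p ∈ C) (hu : u ∈ relInterior C) : y ∈ tangentSet p (relInterior C) ↔
      signVector (activeSet s p) y = signVector (activeSet s p) u :=
  (eventually_congr (eventually_add_smul_mem_relInterior_iff hs hp hu y)).trans eventually_const

/-- A short ray is eventually inside or eventually outside. This is what lets a ray that stays in a
finite union be assigned to one member. -/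
theorem tangentSet_dichotomy (hC : IsPolyhedral C) (p y : U) :
    y ∈ tangentSet p (relInterior C) ∨ ∀ᶠ ε in 𝓝[>] (0 : ℝ), p + ε • y ∉ relInterior C := by
  obtain ⟨s, hs⟩ := hC
  by_cases hp : p ∈ C
  · obtain ⟨u, hu⟩ := relInterior_nonempty ⟨s, hs⟩
    by_cases h : signVector (activeSet s p) y = signVector (activeSet s p) u
    · exact Or.inl ((mem_tangentSet_relInterior_iff hs hp hu).2 h)
    · refine Or.inr ?_
      filter_upwards [eventually_add_smul_mem_relInterior_iff hs hp hu y] with ε hε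
      exact fun h' => h (hε.1 h')
  · refine Or.inr ?_
    filter_upwards [eventually_notMem hs hp y] with ε hε
    exact fun h' => hε h'.1

/-- The tangent set is one cell of the active arrangement. Its span is the span of `C`: the
functionals of `s` that vanish at the interior point `u` vanish on all of `C`, in particular at `p`,
so they are active. -/
theorem hasEulerChar_tangentSet_relInterior (hC : IsPolyhedral C) {p : U} (hp : p ∈ C) :
    HasEulerChar (tangentSet p (relInterior C))
      ((-1) ^ Module.finrank ℝ (Submodule.span ℝ (C : Set U))) := by
  obtain ⟨s, hs⟩ := hC
  obtain ⟨u, hu⟩ := relInterior_nonempty ⟨s, hs⟩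
  have hspan : Submodule.span ℝ (C : Set U) =
      signFlat (activeSet s p) (signVector (activeSet s p) u) := by
    ext x
    rw [mem_span_cone_iff hs, mem_signFlat_signVector]
    simp only [mem_activeSet, and_imp]
    refine forall₂_congr fun f hf => ⟨fun h _ h0 => h (((mem_relInterior_iff hs).1 hu).2 f hf h0),
      fun h h0 => h (h0 p hp) (h0 u hu.1)⟩
  rw [hspan]
  convert hasEulerChar_cell (activeSet s p) u using 1
  ext y
  exact mem_tangentSet_relInterior_iff hs hp hu

open Classical in
theorem hasEulerChar_tangentSet [FiniteDimensional ℝ U] (hC : IsPolyhedral C) {p : U}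
    (hp : p ∈ C) : HasEulerChar (tangentSet p (C : Set U))
      (if p ∈ relInterior C then (-1) ^ Module.finrank ℝ (Submodule.span ℝ (C : Set U))
        else 0) := by
  split_ifs with h
  · convert hasEulerChar_tangentSet_relInterior hC hp using 1
    refine (Set.Subset.antisymm (tangentSet_relInterior_subset p) fun y hy => ?_).symm
    -- Doubling `y` makes `p + ε • y` the midpoint of `p` and a point of `C`, hence a relative
    -- interior point.
    filter_upwards [eventually_mem_of_mem_span hC h (y := (2 : ℝ) • y)
      (Submodule.smul_mem _ _ (mem_span_of_eventually hp hy))] with ε hε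
    have h1 : p + ε • y = (1 / 2 : ℝ) • (p + ε • (2 : ℝ) • y) + (1 / 2 : ℝ) • p := by module
    rw [h1]
    exact add_mem_relInterior (PointedCone.smul_mem _ (by norm_num) hε)
      (smul_mem_relInterior h (by norm_num))
  · obtain ⟨s, hs⟩ := hC
    rw [mem_relInterior_iff hs] at h
    push Not at h
    -- The functional `f` is active at `p` but nonzero at `v ∈ C`, so the tangent cone is not a
    -- linear subspace.
    obtain ⟨f, hf, h0, v, hv, hne⟩ := h hp
    convert hasEulerChar_closed_cone (activeSet s p) v
      (fun g hg => (hs v).1 hv g (mem_activeSet.1 hg).1) ⟨f, mem_activeSet.2 ⟨hf, h0⟩, hne⟩ using 1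
    ext y
    exact mem_tangentSet_iff hs hp

end Polyhedral

/-! ### The local Euler relation for a tiling of a cone -/

section Families

variable {ι : Type*} {S : Finset ι} {D : ι → PointedCone ℝ U} {K : PointedCone ℝ U}

theorem exists_mem_tangentSet_relInterior (hD : ∀ i ∈ S, IsPolyhedral (D i))
    (hcov : ∀ x ∈ K, ∃ i ∈ S, x ∈ relInterior (D i)) {p y : U}
    (hy : y ∈ tangentSet p (K : Set U)) :
    ∃ i ∈ S, p ∈ D i ∧ y ∈ tangentSet p (relInterior (D i)) := by
  by_contra! h
  have h1 : ∀ᶠ ε in 𝓝[>] (0 : ℝ), ∀ i ∈ S, p + ε • y ∉ relInterior (D i) := by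
    rw [eventually_all_finset]
    intro i hi
    refine (tangentSet_dichotomy (hD i hi) p y).resolve_left fun h' => ?_
    exact h i hi (mem_of_tangentSet_nonempty (hD i hi) (tangentSet_relInterior_subset p h')) h'
  obtain ⟨ε, h2, h3⟩ := (h1.and (mem_tangentSet.1 hy)).exists
  obtain ⟨i, hi, h4⟩ := hcov _ h3
  exact h2 i hi h4

open Classical in
/-- The local Euler relation: if the relative interiors of finitely many polyhedral cones partition
a polyhedral cone `K`, then the alternating number of those cones which contain a point `p` of `K`
is the local Euler characteristic of `K` at `p`. -/
theorem sum_neg_one_pow_finrank_span [FiniteDimensional ℝ U] (hD : ∀ i ∈ S, IsPolyhedral (D i))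
    (hK : IsPolyhedral K) (hle : ∀ i ∈ S, D i ≤ K)
    (hcov : ∀ x ∈ K, ∃ i ∈ S, x ∈ relInterior (D i))
    (hdisj : ∀ i ∈ S, ∀ j ∈ S, ∀ x, x ∈ relInterior (D i) → x ∈ relInterior (D j) → i = j)
    {p : U} (hp : p ∈ K) :
    ∑ i ∈ S with p ∈ D i, (-1 : ℤ) ^ Module.finrank ℝ (Submodule.span ℝ (D i : Set U)) =
      if p ∈ relInterior K then (-1) ^ Module.finrank ℝ (Submodule.span ℝ (K : Set U)) else 0 := by
  -- The tangent set of `K` at `p` is the disjoint union of those of the relative interiors of the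
  -- cones through `p`; its Euler characteristic is computed both ways.
  have h1 := HasEulerChar.biUnion (S.filter fun i => p ∈ D i)
    (fun i => tangentSet p (relInterior (D i)))
    (fun i => (-1 : ℤ) ^ Module.finrank ℝ (Submodule.span ℝ (D i : Set U)))
    (fun i hi => hasEulerChar_tangentSet_relInterior (hD i (Finset.mem_filter.1 hi).1)
      (Finset.mem_filter.1 hi).2) (by
      intro i hi j hj x hxi hxj
      obtain ⟨ε, h1, h2⟩ := ((mem_tangentSet.1 hxi).and (mem_tangentSet.1 hxj)).exists
      exact hdisj i (Finset.mem_filter.1 hi).1 j (Finset.mem_filter.1 hj).1 _ h1 h2)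
  refine h1.unique ?_
  convert hasEulerChar_tangentSet hK hp using 1
  ext y
  simp only [Set.mem_iUnion, Finset.mem_filter, exists_prop, and_assoc]
  constructor
  · rintro ⟨i, hi, -, hy⟩
    exact (mem_tangentSet.1 hy).mono fun ε h => hle i hi h.1
  · exact fun hy => exists_mem_tangentSet_relInterior hD hcov hy

end Families

end Cones

/-! ### Ranks on finite posets -/

section Ranks

variable {B : Type*} [PartialOrder B] [Finite B]

theorem covBy_induction {P : B → B → Prop} (hrefl : ∀ z, P z z)
    (hstep : ∀ z x y, z ≤ x → P z x → x ⋖ y → P z y) {z z' : B} (h : z ≤ z') : P z z' := by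
  classical
  have := Fintype.ofFinite B
  let : LocallyFiniteOrder B := Fintype.toLocallyFiniteOrder
  induction le_iff_reflTransGen_covBy.1 h with
  | refl => exact hrefl z
  | tail h1 h2 ih =>
    have h3 := le_iff_reflTransGen_covBy.2 h1
    exact hstep _ _ _ h3 (ih h3) h2

theorem IsRankFunction.monotone {ρ : B → ℤ} (hρ : IsRankFunction ρ) : Monotone ρ := fun _ _ h =>
  covBy_induction (P := fun z z' => ρ z ≤ ρ z') (fun _ => le_rfl)
    (fun _ _ _ _ h1 h2 => h1.trans (by rw [hρ _ _ h2]; lia)) h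

theorem IsRankFunction.sub_eq_sub {ρ ρ' : B → ℤ} (hρ : IsRankFunction ρ) (hρ' : IsRankFunction ρ')
    {z z' : B} (h : z ≤ z') : ρ z' - ρ z = ρ' z' - ρ' z :=
  covBy_induction (P := fun z z' => ρ z' - ρ z = ρ' z' - ρ' z) (fun _ => by simp)
    (fun _ _ _ _ h1 h2 => by rw [hρ _ _ h2, hρ' _ _ h2]; lia) h

/-- On comparable pairs any rank function computes `naturalRank`, whichever one was chosen. The
additive form keeps truncation out of later arithmetic. -/
theorem naturalRank_add {ρ : B → ℕ} (hρ : IsRankFunction fun z => (ρ z : ℤ)) {z z' : B}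
    (h : z ≤ z') : naturalRank z z' + ρ z = ρ z' := by
  have hex : ∃ ρ : B → ℤ, IsRankFunction ρ := ⟨_, hρ⟩
  have h1 : IsRankFunction (rankFunction B) := by
    rw [rankFunction, dif_pos hex]
    exact hex.choose_spec
  have h2 := h1.sub_eq_sub hρ h
  have h3 : ρ z ≤ ρ z' := by exact_mod_cast hρ.monotone h
  rw [naturalRank, h2]
  lia

end Ranks

/-! ### Posets of cones -/

section ConeSystem

open Filter Topology

variable {U : Type*} [AddCommGroup U] [Module ℝ U] {B : Type*} [PartialOrder B]

/-- A family of polyhedral cones indexed by a poset with an upper set `up`. The relative interiors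
of the cones with index outside `up` are disjoint and partition the union of all cones; those with
index in `up` are disjoint and partition a smaller union of cones. This models the cones attached to
the elements of the mapping cylinder of a proper morphism of fans. -/
structure IsConeSystem (up : Set B) (c : B → PointedCone ℝ U) : Prop where
  isUpperSet : IsUpperSet up
  polyhedral : ∀ z, IsPolyhedral (c z)
  mono : Monotone c
  le_of_mem : ∀ z z' x, x ∈ relInterior (c z) → x ∈ c z' → (z ∈ up → z' ∈ up) → z ≤ z'
  exists_mem : ∀ z' x, x ∈ c z' → ∃ z ≤ z', (z ∈ up ↔ z' ∈ up) ∧ x ∈ relInterior (c z)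
  exists_mem_lower : ∀ z' x, x ∈ c z' → z' ∈ up → ∃ z ≤ z', z ∉ up ∧ x ∈ relInterior (c z)

open Classical in
/-- The dimension of the cone, increased by one on the upper set. -/
def coneRank (up : Set B) (c : B → PointedCone ℝ U) (z : B) : ℕ :=
  Module.finrank ℝ (Submodule.span ℝ (c z : Set U)) + if z ∈ up then 1 else 0

namespace IsConeSystem

variable {up : Set B} {c : B → PointedCone ℝ U}

theorem notMem_relInterior (hc : IsConeSystem up c) {z z' : B} (h : z < z')
    (hz : z' ∈ up → z ∈ up) {p : U}
    (hp : p ∈ relInterior (c z)) : p ∉ relInterior (c z') := fun hp' =>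
  h.not_ge (hc.le_of_mem z' z p hp' hp.1 hz)

/-- The local form of the tiling. `b` selects the side: `True` for indices in `up`, `False` for
those outside. -/
theorem exists_tangent (hc : IsConeSystem up c) {b : Prop} {z z' : B} [Finite B]
    (hcov : ∀ x ∈ c z', ∃ i ≤ z', (i ∈ up ↔ b) ∧ x ∈ relInterior (c i)) (hzb : z ∈ up → b)
    {p y : U} (hp : p ∈ relInterior (c z)) (hy : y ∈ tangentSet p (c z' : Set U)) :
    ∃ i, z ≤ i ∧ i ≤ z' ∧ (i ∈ up ↔ b) ∧ y ∈ tangentSet p (relInterior (c i)) := by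
  classical
  have := Fintype.ofFinite B
  obtain ⟨i, hi, h1, h2⟩ := exists_mem_tangentSet_relInterior
    (S := Finset.univ.filter fun i => i ≤ z' ∧ (i ∈ up ↔ b)) (D := c) (K := c z')
    (fun i _ => hc.polyhedral i) (fun x hx => by
      obtain ⟨i, h1, h2, h3⟩ := hcov x hx
      exact ⟨i, by simp [h1, h2], h3⟩) hy
  simp only [Finset.mem_filter, Finset.mem_univ, true_and] at hi
  exact ⟨i, hc.le_of_mem z i p hp h1 fun h => hi.2.2 (hzb h), hi.1, hi.2, h2⟩

open Classical in
-- The local Euler relation at `p`: the indices below `z'` on the chosen side whose cone contains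
-- `p` are exactly those in `[z, z']`, by `le_of_mem`.
theorem sum_side (hc : IsConeSystem up c) [FiniteDimensional ℝ U] [Fintype B] {b : Prop} {z z' : B}
    [DecidablePred fun i => (z ≤ i ∧ i ≤ z') ∧ (i ∈ up ↔ b)] (hzz : z ≤ z')
    (hcov : ∀ x ∈ c z', ∃ i ≤ z', (i ∈ up ↔ b) ∧ x ∈ relInterior (c i)) (hzb : z ∈ up → b)
    {p : U} (hp : p ∈ relInterior (c z)) :
    ∑ i with (z ≤ i ∧ i ≤ z') ∧ (i ∈ up ↔ b),
      (-1 : ℤ) ^ Module.finrank ℝ (Submodule.span ℝ (c i : Set U)) =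
    if p ∈ relInterior (c z') then (-1) ^ Module.finrank ℝ (Submodule.span ℝ (c z' : Set U))
      else 0 := by
  rw [← sum_neg_one_pow_finrank_span (S := Finset.univ.filter fun i => i ≤ z' ∧ (i ∈ up ↔ b))
    (D := c) (K := c z') (fun i _ => hc.polyhedral i) (hc.polyhedral z')
    (fun i hi => hc.mono (Finset.mem_filter.1 hi).2.1) (fun x hx => by
      obtain ⟨i, h1, h2, h3⟩ := hcov x hx
      exact ⟨i, by simp [h1, h2], h3⟩) ?_ (hc.mono hzz hp.1)]
  · refine Finset.sum_congr ?_ fun _ _ => rfl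
    ext i
    simp only [Finset.mem_filter, Finset.mem_univ, true_and]
    constructor
    · rintro ⟨⟨h1, h2⟩, h3⟩
      exact ⟨⟨h2, h3⟩, hc.mono h1 hp.1⟩
    · rintro ⟨⟨h2, h3⟩, h1⟩
      exact ⟨⟨hc.le_of_mem z i p hp h1 fun h => h3.2 (hzb h), h2⟩, h3⟩
  · intro i hi j hj x hxi hxj
    simp only [Finset.mem_filter, Finset.mem_univ, true_and] at hi hj
    exact le_antisymm (hc.le_of_mem i j x hxi hxj.1 fun h => hj.2.2 (hi.2.1 h))
      (hc.le_of_mem j i x hxj hxi.1 fun h => hi.2.2 (hj.2.1 h))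

theorem cov_same (hc : IsConeSystem up c) {z' : B} {b : Prop} (h : z' ∈ up ↔ b) :
    ∀ x ∈ c z', ∃ i ≤ z', (i ∈ up ↔ b) ∧ x ∈ relInterior (c i) := fun x hx => by
  obtain ⟨i, h1, h2, h3⟩ := hc.exists_mem z' x hx
  exact ⟨i, h1, h2.trans h, h3⟩

theorem cov_lower (hc : IsConeSystem up c) {z' : B} :
    ∀ x ∈ c z', ∃ i ≤ z', (i ∈ up ↔ False) ∧ x ∈ relInterior (c i) := fun x hx => by
  by_cases h : z' ∈ up
  · obtain ⟨i, h1, h2, h3⟩ := hc.exists_mem_lower z' x hx h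
    exact ⟨i, h1, by simpa using h2, h3⟩
  · exact hc.cov_same (by simpa using h) x hx

open Classical in
theorem sum_Icc (hc : IsConeSystem up c) [FiniteDimensional ℝ U] [Fintype B] {z z' : B}
    (h : z < z') :
    ∑ i with z ≤ i ∧ i ≤ z', (-1 : ℤ) ^ coneRank up c i = 0 := by
  obtain ⟨p, hp⟩ := relInterior_nonempty (hc.polyhedral z)
  have hlow : ∑ i with (z ≤ i ∧ i ≤ z') ∧ (i ∈ up ↔ False), (-1 : ℤ) ^ coneRank up c i =
      ∑ i with (z ≤ i ∧ i ≤ z') ∧ (i ∈ up ↔ False),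
        (-1 : ℤ) ^ Module.finrank ℝ (Submodule.span ℝ (c i : Set U)) :=
    Finset.sum_congr rfl fun i hi => by
      have := (Finset.mem_filter.1 hi).2.2
      simp only [iff_false] at this
      simp [coneRank, this]
  have hup : ∑ i with (z ≤ i ∧ i ≤ z') ∧ (i ∈ up ↔ True), (-1 : ℤ) ^ coneRank up c i =
      -∑ i with (z ≤ i ∧ i ≤ z') ∧ (i ∈ up ↔ True),
        (-1 : ℤ) ^ Module.finrank ℝ (Submodule.span ℝ (c i : Set U)) := by
    rw [← Finset.sum_neg_distrib]
    refine Finset.sum_congr rfl fun i hi => ?_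
    have := (Finset.mem_filter.1 hi).2.2
    simp only [iff_true] at this
    simp [coneRank, this, pow_succ]
  have hsplit : ∑ i with z ≤ i ∧ i ≤ z', (-1 : ℤ) ^ coneRank up c i =
      ∑ i with (z ≤ i ∧ i ≤ z') ∧ (i ∈ up ↔ True), (-1 : ℤ) ^ coneRank up c i +
      ∑ i with (z ≤ i ∧ i ≤ z') ∧ (i ∈ up ↔ False), (-1 : ℤ) ^ coneRank up c i := by
    rw [← Finset.sum_filter_add_sum_filter_not _ (fun i => i ∈ up)]
    simp only [Finset.filter_filter, iff_true, iff_false]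
  rw [hsplit, hlow, hup]
  -- If the interval meets both sides, the two sums agree and cancel. Otherwise one sum is empty,
  -- and the other is `0` because `p` is not interior to `c z'`.
  by_cases hz' : z' ∈ up
  · rw [hc.sum_side h.le (hc.cov_same (by simpa using hz')) (fun _ => trivial) hp]
    by_cases hz : z ∈ up
    · rw [if_neg (hc.notMem_relInterior h (fun _ => hz) hp), Finset.sum_eq_zero, neg_zero,
        add_zero]
      intro i hi
      obtain ⟨h1, h2⟩ := (Finset.mem_filter.1 hi).2
      exact (h2.1 (hc.isUpperSet h1.1 hz)).elim
    · rw [hc.sum_side h.le hc.cov_lower (fun h => hz h) hp, neg_add_cancel]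
  · have hz : z ∉ up := fun hz => hz' (hc.isUpperSet h.le hz)
    rw [hc.sum_side h.le hc.cov_lower (fun h => hz h) hp,
      if_neg (hc.notMem_relInterior h (fun h => (hz' h).elim) hp), Finset.sum_eq_zero, neg_zero,
      add_zero]
    intro i hi
    obtain ⟨h1, h2⟩ := (Finset.mem_filter.1 hi).2
    exact (hz' (hc.isUpperSet h1.2 (h2.2 trivial))).elim

/-- The cones outside `up` also tile `c z'`. A direction from `p` into `c z'` enters one of them
with index in `[z, z']`, and a cover leaves only `z`; hence it lies in the span of `c z`. -/
theorem finrank_span_of_covBy_of_mem (hc : IsConeSystem up c) [FiniteDimensional ℝ U]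
    [Finite B] {z z' : B} (h : z ⋖ z')
    (hz : z ∉ up) (hz' : z' ∈ up) : Module.finrank ℝ (Submodule.span ℝ (c z' : Set U)) =
      Module.finrank ℝ (Submodule.span ℝ (c z : Set U)) := by
  obtain ⟨p, hp⟩ := relInterior_nonempty (hc.polyhedral z)
  suffices h : Submodule.span ℝ (c z' : Set U) = Submodule.span ℝ (c z : Set U) by rw [h]
  refine le_antisymm (Submodule.span_le.2 fun u hu => ?_) (Submodule.span_mono (hc.mono h.le))
  have hut : u ∈ tangentSet p (c z' : Set U) := by
    filter_upwards [self_mem_nhdsWithin] with ε hε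
    exact (c z').add_mem (hc.mono h.le hp.1) (PointedCone.smul_mem _ (le_of_lt hε) hu)
  obtain ⟨i, h1, h2, h3, h4⟩ := hc.exists_tangent hc.cov_lower (fun h => hz h) hp hut
  simp only [iff_false] at h3
  obtain rfl := (h.eq_or_eq h1 h2).resolve_right fun h => h3 (h ▸ hz')
  exact mem_span_of_eventually hp.1 (tangentSet_relInterior_subset p h4)

/-- The smaller span is the hyperplane `g = 0` in the larger one, for any constraint `g` that is
active at `p` and does not vanish on `c z'`. -/
theorem finrank_span_of_covBy_of_iff (hc : IsConeSystem up c) [FiniteDimensional ℝ U]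
    [Finite B] {z z' : B} (h : z ⋖ z')
    (hz : z ∈ up ↔ z' ∈ up) : Module.finrank ℝ (Submodule.span ℝ (c z' : Set U)) =
      Module.finrank ℝ (Submodule.span ℝ (c z : Set U)) + 1 := by
  obtain ⟨p, hp⟩ := relInterior_nonempty (hc.polyhedral z)
  obtain ⟨s, hs⟩ := hc.polyhedral z'
  obtain ⟨u, hu⟩ := relInterior_nonempty (hc.polyhedral z')
  have hpz' : p ∈ c z' := hc.mono h.le hp.1
  have hpn := hc.notMem_relInterior h.lt hz.2 hp
  rw [mem_relInterior_iff hs] at hpn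
  push Not at hpn
  obtain ⟨g, hg, hgp, v, hv, hgv⟩ := hpn hpz'
  have hgu : 0 < g u := lt_of_le_of_ne ((hs u).1 hu.1 g hg) fun h =>
    hgv (((mem_relInterior_iff hs).1 hu).2 g hg h.symm v hv)
  -- A direction in the boundary of the tangent cone does not enter the relative interior of `c z'`,
  -- so by the covering relation it enters that of `c z`.
  have key : ∀ x, (∀ f ∈ activeSet s p, 0 ≤ f x) → (∃ f ∈ activeSet s p, f x = 0 ∧ f u ≠ 0) →
      x ∈ Submodule.span ℝ (c z : Set U) := by
    rintro x hx ⟨f, hf, hfx, hfu⟩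
    obtain ⟨i, h1, h2, -, h4⟩ := hc.exists_tangent (hc.cov_same Iff.rfl) hz.1 hp
      ((mem_tangentSet_iff hs hpz').2 hx)
    rcases h.eq_or_eq h1 h2 with rfl | rfl
    · exact mem_span_of_eventually hp.1 (tangentSet_relInterior_subset p h4)
    · rw [mem_tangentSet_relInterior_iff hs hpz' hu, signVector_eq_iff] at h4
      have := h4 f hf
      rw [hfx, sign_zero] at this
      exact (hfu (sign_eq_zero_iff.1 this.symm)).elim
  have hgz : ∀ y ∈ Submodule.span ℝ (c z : Set U), g y = 0 := by
    intro y hy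
    have h1 : Submodule.span ℝ (c z : Set U) ≤ LinearMap.ker g := by
      refine Submodule.span_le.2 fun x hx => ?_
      obtain ⟨ε, hε, h1⟩ := hp.2 x hx
      have h2 := (hs _).1 (hc.mono h.le h1) g hg
      have h3 := (hs _).1 (hc.mono h.le hx) g hg
      rw [map_sub, hgp, map_smul, smul_eq_mul] at h2
      rw [SetLike.mem_coe, LinearMap.mem_ker]
      nlinarith
    exact h1 hy
  -- This case is contradictory. Moving from `u` along `y` until the first active constraint becomes
  -- `0` gives, by `key`, a vector in the span of `c z`, where `g` vanishes; but `g` still has the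
  -- value `g u > 0` there.
  have hneg : ∀ y ∈ Submodule.span ℝ (c z' : Set U), (∃ f ∈ activeSet s p, f y < 0) → g y = 0 →
      y ∈ Submodule.span ℝ (c z : Set U) := by
    rintro y hy ⟨f₀, hf₀, hf₀y⟩ hgy
    have hne : ((activeSet s p).filter fun f => f y < 0).Nonempty :=
      ⟨f₀, Finset.mem_filter.2 ⟨hf₀, hf₀y⟩⟩
    obtain ⟨f, hf, hmin⟩ := Finset.exists_min_image _ (fun f => f u / -f y) hne
    obtain ⟨hfs, hfy⟩ := Finset.mem_filter.1 hf
    have hfy' : 0 < -f y := neg_pos.2 hfy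
    have hfu : f u ≠ 0 := fun h0 => hfy.ne ((mem_span_cone_iff hs).1 hy f (mem_activeSet.1 hfs).1
      (((mem_relInterior_iff hs).1 hu).2 f (mem_activeSet.1 hfs).1 h0))
    have hfu' : 0 < f u := lt_of_le_of_ne ((hs u).1 hu.1 f (mem_activeSet.1 hfs).1) hfu.symm
    have h1 : u + (f u / -f y) • y ∈ Submodule.span ℝ (c z : Set U) := by
      refine key _ (fun k hk => ?_) ⟨f, hfs, ?_, hfu⟩
      · rw [map_add, map_smul, smul_eq_mul]
        have hku := (hs u).1 hu.1 k (mem_activeSet.1 hk).1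
        rcases lt_or_ge (k y) 0 with h0 | h0
        · have := (le_div_iff₀ (neg_pos.2 h0)).1 (hmin k (Finset.mem_filter.2 ⟨hk, h0⟩))
          linarith
        · have := mul_nonneg (div_nonneg hfu'.le hfy'.le) h0
          linarith
      · rw [map_add, map_smul, smul_eq_mul, div_mul_eq_mul_div, div_neg,
          mul_div_cancel_right₀ _ hfy.ne, add_neg_cancel]
    have h2 := hgz _ h1
    rw [map_add, map_smul, hgy, smul_zero, add_zero] at h2
    exact (hgu.ne' h2).elim
  have hspan : Submodule.span ℝ (c z : Set U) =
      Submodule.span ℝ (c z' : Set U) ⊓ LinearMap.ker g := by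
    refine le_antisymm (fun y hy => ⟨Submodule.span_mono (hc.mono h.le) hy, hgz y hy⟩) ?_
    rintro y ⟨hy, hgy⟩
    have hgy : g y = 0 := hgy
    by_cases h1 : ∃ f ∈ activeSet s p, f y < 0
    · exact hneg y hy h1 hgy
    · push Not at h1
      exact key y h1 ⟨g, mem_activeSet.2 ⟨hg, hgp⟩, hgy, hgu.ne'⟩
  rw [hspan, finrank_inf_ker _ g (Submodule.subset_span hu.1) hgu.ne']

theorem isRankFunction (hc : IsConeSystem up c) [FiniteDimensional ℝ U] [Finite B] :
    IsRankFunction fun z => (coneRank up c z : ℤ) := by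
  intro z z' h
  by_cases hz : z ∈ up
  · have hz' := hc.isUpperSet h.le hz
    simp only [coneRank, if_pos hz, if_pos hz',
      hc.finrank_span_of_covBy_of_iff h (iff_of_true hz hz')]
    lia
  · by_cases hz' : z' ∈ up
    · simp only [coneRank, if_neg hz, if_pos hz', hc.finrank_span_of_covBy_of_mem h hz hz']
      lia
    · simp only [coneRank, if_neg hz, if_neg hz',
        hc.finrank_span_of_covBy_of_iff h (iff_of_false hz hz')]
      lia

theorem isLowerEulerian (hc : IsConeSystem up c) [FiniteDimensional ℝ U] [Finite B] [Nonempty B] :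
    IsLowerEulerian B := by
  classical
  have := Fintype.ofFinite B
  refine ⟨inferInstance, ?_, _, hc.isRankFunction, fun z z' h => ?_⟩
  · obtain ⟨z₁⟩ := ‹Nonempty B›
    -- The least element is the index outside `up` whose cone has the origin in its relative
    -- interior; every cone contains the origin.
    obtain ⟨z₀, -, h1, h2⟩ := hc.cov_lower (z' := z₁) 0 (c z₁).zero_mem
    have hle : ∀ z, z₀ ≤ z := fun z => hc.le_of_mem z₀ z 0 h2 (c z).zero_mem fun h => (h1.1 h).elim
    exact ⟨z₀, fun z _ => hle z, fun z hz => le_antisymm (hz (hle z)) (hle z)⟩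
  · rw [finsum_eq_sum_of_fintype, ← hc.sum_Icc h]
    simp only [Int.coe_negOnePow_natCast]
    refine (Finset.sum_subtype _ (fun x => ?_) fun i => (-1 : ℤ) ^ coneRank up c i).symm
    simp [Set.mem_Icc]

/-! ### Fixed points -/

/-- A fixed interior point gives `z ≤ a z`. Since `a` has finite order, iterating leads back to `z`,
so equality holds. -/
theorem map_eq_of_mem_relInterior (hc : IsConeSystem up c) [Finite B] (a : B ≃o B) (g : U →ₗ[ℝ] U)
    (hg : ∀ z, ∀ v ∈ c z, g v ∈ c (a z)) (hup : ∀ z, z ∈ up → a z ∈ up) {z : B} {x : U}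
    (hx : x ∈ relInterior (c z)) (hgx : g x = x) : a z = z := by
  have h1 : z ≤ a z := hc.le_of_mem _ _ x hx (by have := hg z x hx.1; rwa [hgx] at this) (hup z)
  have h2 : ∀ k : ℕ, a z ≤ (a ^ k) (a z) := by
    intro k
    induction k with
    | zero => simp
    | succ k ih =>
      rw [pow_succ', RelIso.mul_apply]
      exact a.monotone (h1.trans ih)
  have : Finite (B ≃o B) := DFunLike.finite _
  obtain ⟨n, hn, h3⟩ := isOfFinOrder_iff_pow_eq_one.1 (isOfFinOrder_of_finite a)
  refine le_antisymm ?_ h1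
  have h4 := h2 (n - 1)
  rwa [← RelIso.mul_apply, ← pow_succ, Nat.sub_add_cancel hn, h3, RelIso.one_apply] at h4

end IsConeSystem

theorem isPolyhedral_comap {U' : Type*} [AddCommGroup U'] [Module ℝ U'] {C : PointedCone ℝ U}
    (hC : IsPolyhedral C) (f : U' →ₗ[ℝ] U) : IsPolyhedral (C.comap f) := by
  classical
  obtain ⟨s, hs⟩ := hC
  refine ⟨s.image fun h => h.comp f, fun v => ?_⟩
  rw [PointedCone.mem_comap, hs, Finset.forall_mem_image]
  rfl

/-- The subspace of fixed vectors. -/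
abbrev fixedSubmodule (g : U →ₗ[ℝ] U) : Submodule ℝ U := LinearMap.eqLocus g LinearMap.id

/-- For `y ∈ C` the orbit sum `m` of `y` is a fixed vector of `C`, and `m - y ∈ C`. Hence room to
subtract a multiple of `m` is room to subtract the same multiple of `y`. -/
theorem mem_relInterior_of_fixed {C : PointedCone ℝ U} {g : U →ₗ[ℝ] U} {n : ℕ} (hn : 0 < n)
    (hgn : g ^ n = 1) (hgC : ∀ v ∈ C, g v ∈ C) {x : fixedSubmodule g} :
    x ∈ relInterior (C.comap (fixedSubmodule g).subtype) ↔ (x : U) ∈ relInterior C := by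
  constructor
  · rintro ⟨hx, h⟩
    refine ⟨hx, fun y hy => ?_⟩
    have hpow : ∀ k : ℕ, (g ^ k) y ∈ C := by
      intro k
      induction k with
      | zero => exact hy
      | succ k ih => rw [pow_succ']; exact hgC _ ih
    set m : U := ∑ k ∈ Finset.range n, (g ^ k) y with hm
    have hmg : g m = m := by
      rw [hm, map_sum]
      have h1 : ∀ k, g ((g ^ k) y) = (g ^ (k + 1)) y := fun k => by rw [pow_succ']; rfl
      simp_rw [h1]
      have h2 := Finset.sum_range_succ' (fun k => (g ^ k) y) n
      rw [Finset.sum_range_succ, hgn, pow_zero] at h2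
      exact (add_right_cancel h2).symm
    obtain ⟨ε, hε, h1⟩ := h ⟨m, hmg⟩ (show m ∈ C from C.sum_mem fun k _ => hpow k)
    refine ⟨ε, hε, ?_⟩
    have h2 : m = y + ∑ k ∈ Finset.range (n - 1), (g ^ (k + 1)) y := by
      rw [hm]
      conv_lhs => rw [← Nat.sub_add_cancel hn, Finset.sum_range_succ']
      rw [pow_zero, add_comm]
      rfl
    have h3 : (x : U) - ε • y =
        ((x : U) - ε • m) + ε • ∑ k ∈ Finset.range (n - 1), (g ^ (k + 1)) y := by
      rw [h2]; module
    rw [h3]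
    exact C.add_mem h1 (PointedCone.smul_mem _ hε.le (C.sum_mem fun k _ => hpow _))
  · rintro ⟨hx, h⟩
    refine ⟨hx, fun y hy => ?_⟩
    obtain ⟨ε, hε, h1⟩ := h y hy
    exact ⟨ε, hε, h1⟩

/-- An interior point of the fixed part is interior to `C`, so from there a fixed direction in the
span of `C` stays in `C`. -/
theorem span_fixed {C : PointedCone ℝ U} (hC : IsPolyhedral C) {g : U →ₗ[ℝ] U} {n : ℕ} (hn : 0 < n)
    (hgn : g ^ n = 1) (hgC : ∀ v ∈ C, g v ∈ C) :
    Submodule.span ℝ (C.comap (fixedSubmodule g).subtype : Set (fixedSubmodule g)) =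
      (Submodule.span ℝ (C : Set U)).comap (fixedSubmodule g).subtype := by
  have hC' := isPolyhedral_comap hC (fixedSubmodule g).subtype
  refine le_antisymm (Submodule.span_le.2 fun x hx => Submodule.subset_span hx) fun x hx => ?_
  obtain ⟨p, hp⟩ := relInterior_nonempty hC'
  refine mem_span_of_eventually hp.1 ?_
  exact eventually_mem_of_mem_span hC ((mem_relInterior_of_fixed hn hgn hgC).1 hp) hx

/-- The tile containing a fixed point in its relative interior has a fixed index, so the tilings
restrict to the fixed space. -/
theorem IsConeSystem.fixed [Finite B] {up : Set B} {c : B → PointedCone ℝ U}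
    (hc : IsConeSystem up c) (a : B ≃o B) (g : U →ₗ[ℝ] U) {n : ℕ} (hn : 0 < n) (hgn : g ^ n = 1)
    (hg : ∀ z, ∀ v ∈ c z, g v ∈ c (a z)) (hup : ∀ z, z ∈ up → a z ∈ up) :
    IsConeSystem (B := {z : B // a z = z}) {z | z.1 ∈ up}
      fun z => (c z.1).comap (fixedSubmodule g).subtype := by
  have hrel : ∀ (z : {z : B // a z = z}) (x : fixedSubmodule g),
      x ∈ relInterior ((c z.1).comap (fixedSubmodule g).subtype) ↔
        (x : U) ∈ relInterior (c z.1) := fun z x =>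
    mem_relInterior_of_fixed hn hgn fun v hv => by have := hg z.1 v hv; rwa [z.2] at this
  refine ⟨fun z z' h hz => hc.isUpperSet h hz, fun z => isPolyhedral_comap (hc.polyhedral _) _,
    fun z z' h x hx => hc.mono h hx, fun z z' x hx hx' h => ?_, fun z' x hx => ?_,
    fun z' x hx hz' => ?_⟩
  · exact hc.le_of_mem z.1 z'.1 x ((hrel z x).1 hx) hx' h
  · obtain ⟨z, h1, h2, h3⟩ := hc.exists_mem z'.1 x hx
    have hz := hc.map_eq_of_mem_relInterior a g hg hup h3 x.2
    exact ⟨⟨z, hz⟩, h1, h2, (hrel ⟨z, hz⟩ x).2 h3⟩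
  · obtain ⟨z, h1, h2, h3⟩ := hc.exists_mem_lower z'.1 x hx hz'
    have hz := hc.map_eq_of_mem_relInterior a g hg hup h3 x.2
    exact ⟨⟨z, hz⟩, h1, h2, (hrel ⟨z, hz⟩ x).2 h3⟩

end ConeSystem

/-! ### The cones of the mapping cylinder of a proper morphism of fans -/

namespace Fan

variable {V : Type*} [AddCommGroup V] [Module ℝ V] (S : Fan V)

theorem isPolyhedral {C : PointedCone ℝ V} (hC : C ∈ S.cones) : IsPolyhedral C :=
  S.polyhedral C hC

theorem le_of_mem_relInterior {C D : PointedCone ℝ V} (hC : C ∈ S.cones) (hD : D ∈ S.cones) {x : V}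
    (hx : x ∈ relInterior C) (hxD : x ∈ D) : C ≤ D :=
  inf_eq_left.1 (eq_of_isFaceOf_of_mem_relInterior (S.inter_face C hC D hD).1 hx ⟨hx.1, hxD⟩)

theorem exists_mem_relInterior (C : S.Face) {x : V} (hx : x ∈ C.1) :
    ∃ F : S.Face, F ≤ C ∧ x ∈ relInterior F.1 :=
  ⟨⟨minimalFace C.1 x hx, S.face_mem _ C.2 _ (minimalFace_isFaceOf _ _ hx)⟩,
    (minimalFace_isFaceOf _ _ hx).le, mem_relInterior_minimalFace _ _ hx⟩

end Fan

namespace EquivariantFanMorphism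

variable {W V' V : Type*} [Group W] [AddCommGroup V'] [Module ℝ V'] [AddCommGroup V] [Module ℝ V]
  (D : EquivariantFanMorphism W V' V)

/-- The part of the mapping cylinder that comes from the target. -/
def upperPart : Set D.Γ := {z | ∃ y, z = .inY y}

theorem inX_notMem_upperPart (x : D.source.Face) : (.inX x : D.Γ) ∉ D.upperPart := by
  rintro ⟨y, hy⟩
  cases hy

theorem inY_mem_upperPart (y : D.target.Face) : (.inY y : D.Γ) ∈ D.upperPart := ⟨y, rfl⟩

theorem inX_le_inX {x x' : D.source.Face} :
    (.inX x : D.Γ) ≤ .inX x' ↔ x ≤ x' := Iff.rfl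

theorem inX_le_inY {x : D.source.Face} {y : D.target.Face} :
    (.inX x : D.Γ) ≤ .inY y ↔ x.1.map D.φ ≤ y.1 := Fan.faceMap_le_iff D.isMorphism x y

theorem inY_le_inY {y y' : D.target.Face} :
    (.inY y : D.Γ) ≤ .inY y' ↔ y ≤ y' := Iff.rfl

theorem not_inY_le_inX {x : D.source.Face} {y : D.target.Face} :
    ¬ (.inY y : D.Γ) ≤ .inX x := id

instance : Nonempty D.Γ := ⟨.inX ⟨_, D.source.nonempty.some_mem⟩⟩

/-- If `x` maps into `E`, then `E ⊓ y` is a face of `E`, so its preimage cuts out a face of `x`.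
This face contains the interior point `p` and is therefore all of `x`. -/
theorem map_le_of_mem_relInterior {x : D.source.Face} {y : D.target.Face} {p : V'}
    (hp : p ∈ relInterior x.1) (hpy : D.φ p ∈ y.1) : x.1.map D.φ ≤ y.1 := by
  obtain ⟨E, hE, hle⟩ := D.isMorphism x.1 x.2
  have hface := (D.target.inter_face E hE y.1 y.2).1
  have hle' : x.1 ≤ E.comap D.φ := fun v hv => hle ⟨v, hv, rfl⟩
  have h1 : (x.1 ⊓ (E ⊓ y.1).comap D.φ).IsFaceOf x.1 := by
    have := (PointedCone.IsFaceOf.refl x.1).inf (hface.comap D.φ)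
    rwa [inf_eq_left.2 hle'] at this
  have h2 := eq_of_isFaceOf_of_mem_relInterior h1 hp ⟨hp.1, hle' hp.1, hpy⟩
  rintro _ ⟨v, hv, rfl⟩
  rw [SetLike.mem_coe, ← h2] at hv
  exact hv.2.2

theorem map_mem_relInterior (hsurj : Function.Surjective D.φ) {C : PointedCone ℝ V} {p : V'}
    (hp : p ∈ relInterior (C.comap D.φ)) : D.φ p ∈ relInterior C := by
  refine ⟨hp.1, fun y hy => ?_⟩
  obtain ⟨v, rfl⟩ := hsurj y
  obtain ⟨ε, hε, h⟩ := hp.2 v hy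
  refine ⟨ε, hε, ?_⟩
  rw [← map_smul, ← map_sub]
  exact h

theorem mem_relInterior_comap {C : PointedCone ℝ V} {p : V'}
    (hp : D.φ p ∈ relInterior C) : p ∈ relInterior (C.comap D.φ) := by
  refine ⟨hp.1, fun y hy => ?_⟩
  obtain ⟨ε, hε, h⟩ := hp.2 _ hy
  have h1 : D.φ p - ε • D.φ y = D.φ (p - ε • y) := by rw [map_sub, map_smul]
  exact ⟨ε, hε, show D.φ (p - ε • y) ∈ C from h1 ▸ h⟩

theorem upperPart_isUpperSet : IsUpperSet D.upperPart := by
  rintro _ (x | y) h ⟨y', rfl⟩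
  · exact (D.not_inY_le_inX h).elim
  · exact D.inY_mem_upperPart y

theorem cone_mono : Monotone D.cone := by
  rintro (x | y) (x' | y') h
  · exact D.inX_le_inX.1 h
  · exact fun v hv => D.inX_le_inY.1 h ⟨v, hv, rfl⟩
  · exact (D.not_inY_le_inX h).elim
  · exact fun v hv => D.inY_le_inY.1 h hv

/-- Properness is needed for the tiling of preimages of target cones by source cones, surjectivity
for comparing two target cones through an interior point of a preimage. -/
theorem isConeSystem (hproper : D.source.IsProper D.target D.φ)
    (hsurj : Function.Surjective D.φ) : IsConeSystem D.upperPart D.cone where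
  isUpperSet := D.upperPart_isUpperSet
  polyhedral := by
    rintro (x | y)
    · exact D.source.isPolyhedral x.2
    · exact isPolyhedral_comap (D.target.isPolyhedral y.2) _
  mono := D.cone_mono
  le_of_mem := by
    rintro (x | y) (x' | y') p hp hp' h
    · exact D.inX_le_inX.2 (D.source.le_of_mem_relInterior x.2 x'.2 hp hp')
    · exact D.inX_le_inY.2 (D.map_le_of_mem_relInterior hp hp')
    · exact (D.inX_notMem_upperPart x' (h (D.inY_mem_upperPart y))).elim
    · exact D.inY_le_inY.2 (D.target.le_of_mem_relInterior y.2 y'.2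
        (D.map_mem_relInterior hsurj hp) hp')
  exists_mem := by
    rintro (x | y) p hp
    · obtain ⟨F, h1, h2⟩ := D.source.exists_mem_relInterior x hp
      exact ⟨.inX F, D.inX_le_inX.2 h1,
        iff_of_false (D.inX_notMem_upperPart _) (D.inX_notMem_upperPart _), h2⟩
    · obtain ⟨F, h1, h2⟩ := D.target.exists_mem_relInterior y hp
      exact ⟨.inY F, D.inY_le_inY.2 h1,
        iff_of_true (D.inY_mem_upperPart _) (D.inY_mem_upperPart _), D.mem_relInterior_comap h2⟩
  exists_mem_lower := by
    rintro (x | y) p hp h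
    · exact (D.inX_notMem_upperPart x h).elim
    · have h1 : p ∈ D.source.support := by
        rw [← hproper]
        exact ⟨y.1, y.2, hp⟩
      obtain ⟨C, hC, hpC⟩ := h1
      obtain ⟨F, -, h2⟩ := D.source.exists_mem_relInterior ⟨C, hC⟩ hpC
      exact ⟨.inX F, D.inX_le_inY.2 (D.map_le_of_mem_relInterior h2 hp),
        D.inX_notMem_upperPart F, h2⟩

theorem action_mem_upperPart (w : W) (z : D.Γ) (hz : z ∈ D.upperPart) :
    D.action w z ∈ D.upperPart := by
  obtain ⟨y, rfl⟩ := hz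
  exact ⟨_, rfl⟩

end EquivariantFanMorphism

/-! ### Characteristic polynomials of endomorphisms of finite order -/

section Charpoly

open Polynomial Module

/-- In a basis adapted to `N` the matrix is block triangular. -/
theorem LinearMap.charpoly_eq_restrict_mul_mapQ {K M : Type*} [Field K] [AddCommGroup M]
    [Module K M]
    [FiniteDimensional K M] (N : Submodule K M) (f : M →ₗ[K] M) (hf : N ≤ N.comap f) :
    f.charpoly = (f.restrict hf).charpoly * (N.mapQ N f hf).charpoly := by
  let bN := Free.chooseBasis K N
  let bQ := Free.chooseBasis K (M ⧸ N)
  let b := bN.sumQuot bQ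
  have h : LinearMap.toMatrix b b f = Matrix.fromBlocks (LinearMap.toMatrix bN bN (f.restrict hf))
      (Matrix.of fun i l => b.repr (f (b (Sum.inr l))) (Sum.inl i)) 0
      (LinearMap.toMatrix bQ bQ (N.mapQ N f hf)) := by
    ext (i | j) (k | l)
    · simp only [b, Basis.sumQuot_inl, Matrix.fromBlocks_apply₁₁, LinearMap.toMatrix_apply]
      apply Basis.sumQuot_repr_inl_of_mem
    · simp [b, LinearMap.toMatrix_apply, Matrix.fromBlocks_apply₁₂]
    · suffices N.mkQ (f (bN k)) = 0 by simp [LinearMap.toMatrix_apply, b, this]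
      rw [← LinearMap.mem_ker, Submodule.ker_mkQ]
      exact hf (Submodule.coe_mem (bN k))
    · simp only [LinearMap.toMatrix_apply, Basis.sumQuot_repr_inr, Matrix.fromBlocks_apply₂₂, b]
      rw [← Basis.sumQuot_inr bN bQ l, N.mapQ_apply]
      simp
  rw [← f.charpoly_toMatrix b, h, Matrix.charpoly_fromBlocks_zero₂₁, LinearMap.charpoly_toMatrix,
    LinearMap.charpoly_toMatrix]

theorem isSemisimple_of_pow_eq_one {K M : Type*} [Field K] [CharZero K] [AddCommGroup M]
    [Module K M]
    [FiniteDimensional K M] {f : End K M} {n : ℕ} (hn : 0 < n) (hf : f ^ n = 1) :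
    f.IsSemisimple := by
  refine End.isSemisimple_of_squarefree_aeval_eq_zero (p := X ^ n - C 1)
    (separable_X_pow_sub_C (1 : K) (Nat.cast_ne_zero.2 hn.ne') one_ne_zero).squarefree ?_
  simp [hf]

theorem exists_eigenbasis_of_pow_eq_one {M : Type*} [AddCommGroup M] [Module ℂ M]
    [FiniteDimensional ℂ M] {f : End ℂ M} {n : ℕ} (hn : 0 < n) (hf : f ^ n = 1) :
    ∃ (b : Basis (Fin (finrank ℂ M)) ℂ M) (l : Fin (finrank ℂ M) → ℂ),
      (∀ i, f (b i) = l i • b i) ∧ ∀ i, l i ^ n = 1 := by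
  classical
  have h := DirectSum.isInternal_submodule_of_iSupIndep_of_iSup_eq_top
    f.eigenspaces_iSupIndep (isSemisimple_of_pow_eq_one hn hf).iSup_eigenspace_eq_top
  let b₀ := h.collectedBasis fun μ => finBasis ℂ (f.eigenspace μ)
  have : Finite (Σ μ : ℂ, Fin (finrank ℂ (f.eigenspace μ))) := Module.Finite.finite_basis b₀
  have := Fintype.ofFinite (Σ μ : ℂ, Fin (finrank ℂ (f.eigenspace μ)))
  let e : (Σ μ : ℂ, Fin (finrank ℂ (f.eigenspace μ))) ≃ Fin (finrank ℂ M) :=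
    Fintype.equivFinOfCardEq (finrank_eq_card_basis b₀).symm
  have hb : ∀ i, f (b₀.reindex e i) = (e.symm i).1 • b₀.reindex e i := fun i => by
    rw [Basis.reindex_apply]
    exact End.mem_eigenspace_iff.1 (h.collectedBasis_mem _ (e.symm i))
  refine ⟨b₀.reindex e, fun i => (e.symm i).1, hb, fun i => ?_⟩
  have h1 : ∀ k : ℕ, (f ^ k) (b₀.reindex e i) = ((e.symm i).1 ^ k) • b₀.reindex e i := by
    intro k
    induction k with
    | zero => simp
    | succ k ih => rw [pow_succ', End.mul_apply, ih, map_smul, hb, smul_smul, pow_succ]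
  have h2 := h1 n
  rw [hf, End.one_apply] at h2
  by_contra hne
  have h3 : ((e.symm i).1 ^ n - 1) • b₀.reindex e i = 0 := by
    rw [sub_smul, ← h2, one_smul, sub_self]
  exact (smul_eq_zero.1 h3).elim (sub_ne_zero.2 hne) ((b₀.reindex e).ne_zero i)

theorem toMatrix_of_eigenbasis {R M ι : Type*} [CommRing R] [AddCommGroup M] [Module R M]
    [Fintype ι]
    [DecidableEq ι] {f : End R M} (b : Basis ι R M) {l : ι → R} (h : ∀ i, f (b i) = l i • b i) :
    LinearMap.toMatrix b b f = Matrix.diagonal l := by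
  ext i j
  rw [LinearMap.toMatrix_apply, h, map_smul, Basis.repr_self, Matrix.diagonal_apply]
  by_cases hij : i = j
  · subst hij; simp
  · simp [hij]

theorem charpoly_of_eigenbasis {R M ι : Type*} [CommRing R] [Nontrivial R] [AddCommGroup M]
    [Module R M] [Module.Finite R M] [Module.Free R M] [Fintype ι] [DecidableEq ι] {f : End R M}
    (b : Basis ι R M) {l : ι → R} (h : ∀ i, f (b i) = l i • b i) :
    f.charpoly = ∏ i, (X - C (l i)) := by
  rw [← f.charpoly_toMatrix b, toMatrix_of_eigenbasis b h, Matrix.charpoly_diagonal]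

/-- Wedges of eigenvectors form an eigenbasis of the exterior power, with the products of the
eigenvalues as eigenvalues. -/
theorem trace_exteriorPower_map_of_eigenbasis {R M ι : Type*} [CommRing R] [AddCommGroup M]
    [Module R M] [Fintype ι] [LinearOrder ι] {f : End R M} (b : Basis ι R M) {l : ι → R}
    (h : ∀ i, f (b i) = l i • b i) (m : ℕ) :
    LinearMap.trace R _ (exteriorPower.map m f) = (Finset.univ.val.map l).esymm m := by
  classical
  have := Fintype.ofFinite (Set.powersetCard ι m)
  have hb : ∀ s, exteriorPower.map m f (b.exteriorPower m s) =
      (∏ i ∈ s.1, l i) • b.exteriorPower m s := by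
    intro s
    rw [exteriorPower.basis_apply, exteriorPower.map_apply_ιMulti_family]
    simp only [exteriorPower.ιMulti_family]
    have h1 : (f ∘ b) ∘ (Set.powersetCard.ofFinEmbEquiv.symm s) = fun i =>
        l (Set.powersetCard.ofFinEmbEquiv.symm s i) •
          (b ∘ (Set.powersetCard.ofFinEmbEquiv.symm s)) i := by
      funext i
      exact h _
    rw [h1, AlternatingMap.map_smul_univ]
    congr 1
    have h2 : s.1 = Finset.univ.map (Set.powersetCard.ofFinEmbEquiv.symm s).toEmbedding := by
      ext i
      rw [Finset.mem_map]
      have := Set.powersetCard.mem_range_ofFinEmbEquiv_symm_iff_mem s i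
      simpa [Set.mem_range] using (Set.powersetCard.mem_coe_iff.trans this.symm)
    conv_rhs => rw [h2]
    rw [Finset.prod_map]
    rfl
  rw [LinearMap.trace_eq_matrix_trace R (b.exteriorPower m), toMatrix_of_eigenbasis _ hb,
    Matrix.trace_diagonal, Finset.esymm_map_val]
  refine (Finset.sum_subtype _ (fun s => ?_) fun s => ∏ i ∈ s, l i).symm
  simp [Finset.mem_powersetCard, Set.powersetCard.mem_iff]

theorem sum_trace_exteriorPower_map {M : Type*} [AddCommGroup M] [Module ℂ M]
    [FiniteDimensional ℂ M] {f : End ℂ M} {n : ℕ} (hn : 0 < n) (hf : f ^ n = 1) :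
    ∑ m ∈ Finset.range (finrank ℂ M + 1),
      C ((-1) ^ m * LinearMap.trace ℂ _ (exteriorPower.map m f)) * X ^ (finrank ℂ M - m) =
    f.charpoly := by
  obtain ⟨b, l, hb, -⟩ := exists_eigenbasis_of_pow_eq_one hn hf
  have h := Multiset.prod_X_sub_X_eq_sum_esymm (Finset.univ.val.map l)
  rw [Multiset.map_map, Multiset.card_map, Finset.card_val, Finset.card_univ, Fintype.card_fin] at h
  rw [charpoly_of_eigenbasis b hb]
  refine Eq.trans ?_ h.symm
  refine Finset.sum_congr rfl fun m _ => ?_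
  rw [trace_exteriorPower_map_of_eigenbasis b hb]
  simp [mul_assoc]

theorem reflect_prod_X_sub_C {R ι : Type*} [CommRing R] [Nontrivial R] (s : Finset ι) (l : ι → R) :
    reflect s.card (∏ i ∈ s, (X - C (l i))) = ∏ i ∈ s, (1 - C (l i) * X) := by
  classical
  induction s using Finset.induction_on with
  | empty => simp
  | insert a s ha ih =>
    rw [Finset.prod_insert ha, Finset.prod_insert ha, Finset.card_insert_of_notMem ha, add_comm,
      reflect_mul _ _ (natDegree_X_sub_C_le _) (natDegree_finsetProd_X_sub_C_eq_card s l).le, ih,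
      reflect_sub, reflect_one_X, reflect_C, pow_one]

/-- By semisimplicity the geometric and algebraic multiplicities of the eigenvalue `1` agree. -/
theorem finrank_fixedSubmodule_eq_rootMultiplicity {M : Type*} [AddCommGroup M] [Module ℝ M]
    [FiniteDimensional ℝ M] {f : End ℝ M} {n : ℕ} (hn : 0 < n) (hf : f ^ n = 1) :
    finrank ℝ (fixedSubmodule f) = f.charpoly.rootMultiplicity 1 := by
  have h1 : fixedSubmodule f = f.eigenspace 1 := by
    ext x
    simp [LinearMap.mem_eqLocus]
  rw [← LinearMap.finrank_maxGenEigenspace_eq, h1,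
    (isSemisimple_of_pow_eq_one hn hf).isFinitelySemisimple.maxGenEigenspace_eq_eigenspace]

/-- The characteristic polynomial of a real endomorphism of finite order is palindromic up to the
sign `(-1)^k`, where `k` is the dimension of the space of fixed vectors. -/
theorem reflect_charpoly_of_pow_eq_one {M : Type*} [AddCommGroup M] [Module ℝ M]
    [FiniteDimensional ℝ M] {f : End ℝ M} {n : ℕ} (hn : 0 < n) (hf : f ^ n = 1) :
    reflect (finrank ℝ M) (f.charpoly.map (algebraMap ℝ ℂ)) =
      (-1) ^ finrank ℝ (fixedSubmodule f) * f.charpoly.map (algebraMap ℝ ℂ) := by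
  have hd : finrank ℂ (ℂ ⊗[ℝ] M) = finrank ℝ M := finrank_baseChange
  have hfC : (f.baseChange ℂ : End ℂ (ℂ ⊗[ℝ] M)) ^ n = 1 := by
    rw [← LinearMap.baseChange_pow, hf]
    exact LinearMap.baseChange_one ℝ M
  obtain ⟨b, l, hb, hl⟩ := exists_eigenbasis_of_pow_eq_one hn hfC
  have hP : f.charpoly.map (algebraMap ℝ ℂ) = ∏ i, (X - C (l i)) := by
    rw [← LinearMap.charpoly_baseChange, charpoly_of_eigenbasis b hb]
  -- The polynomial is real, so conjugation permutes its roots; the roots are roots of unity, so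
  -- conjugation also inverts them.
  have hconj : ∏ i, (X - C ((starRingEnd ℂ) (l i))) = ∏ i, (X - C (l i)) := by
    have h1 := congrArg (Polynomial.map (starRingEnd ℂ)) hP
    rw [Polynomial.map_map, Polynomial.map_prod] at h1
    have h2 : (starRingEnd ℂ).comp (algebraMap ℝ ℂ) = algebraMap ℝ ℂ := by
      ext x; simp
    rw [h2, hP] at h1
    rw [h1]
    simp
  have hll : ∀ i, l i * (starRingEnd ℂ) (l i) = 1 := fun i => by
    rw [Complex.mul_conj, Complex.normSq_eq_norm_sq,
      Complex.norm_eq_one_of_pow_eq_one (hl i) hn.ne']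
    simp
  obtain ⟨c, hc⟩ : ∃ c : ℂ, reflect (finrank ℝ M) (f.charpoly.map (algebraMap ℝ ℂ)) =
      C c * f.charpoly.map (algebraMap ℝ ℂ) := by
    -- `1 - l X = -l (X - l⁻¹)`, and the inverses are again all the roots.
    refine ⟨∏ i, -(l i), ?_⟩
    have h1 := reflect_prod_X_sub_C Finset.univ l
    rw [Finset.card_univ, Fintype.card_fin] at h1
    rw [hP, ← hd, h1]
    conv_rhs => rw [← hconj]
    rw [map_prod, ← Finset.prod_mul_distrib]
    refine Finset.prod_congr rfl fun i _ => ?_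
    rw [mul_sub, ← C_mul, neg_mul, hll, C_neg, C_neg, C_1]
    ring
  -- To find `c`, split off the factor `(X - 1)^k`, whose reversal contributes `(-1)^k`. The
  -- cofactor `Q` and its reversal have the same nonzero value at `1`, so `c = (-1)^k`.
  obtain ⟨Q, hQ, hdvd⟩ :=
    exists_eq_pow_rootMultiplicity_mul_and_not_dvd f.charpoly f.charpoly_monic.ne_zero 1
  set k := f.charpoly.rootMultiplicity 1 with hk
  have hQ0 : Q ≠ 0 := by rintro rfl; exact hdvd (dvd_zero _)
  have hQ1 : Q.eval 1 ≠ 0 := fun h => hdvd (dvd_iff_isRoot.2 h)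
  have hdeg : finrank ℝ M = k + Q.natDegree := by
    rw [← f.charpoly_natDegree, hQ, natDegree_mul (pow_ne_zero _ (X_sub_C_ne_zero _)) hQ0,
      natDegree_pow, natDegree_X_sub_C, mul_one]
  have hPC : f.charpoly.map (algebraMap ℝ ℂ) =
      (∏ _i : Fin k, (X - C 1)) * Q.map (algebraMap ℝ ℂ) := by
    conv_lhs => rw [hQ]
    simp
  have hpow := reflect_prod_X_sub_C (R := ℂ) (Finset.univ : Finset (Fin k)) fun _ => 1
  rw [Finset.card_univ, Fintype.card_fin] at hpow
  have hne : (∏ _i : Fin k, (X - C 1) : ℂ[X]) ≠ 0 :=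
    Finset.prod_ne_zero_iff.2 fun _ _ => X_sub_C_ne_zero _
  have hpow' : (∏ _i : Fin k, (1 - C 1 * X) : ℂ[X]) = (-1) ^ k * ∏ _i : Fin k, (X - C 1) := by
    simp only [Finset.prod_const, Finset.card_univ, Fintype.card_fin, ← mul_pow]
    congr 1
    simp
  have h1 := hc
  rw [hPC, hdeg, reflect_mul _ _ (by
      rw [natDegree_finsetProd_X_sub_C_eq_card, Finset.card_univ,
        Fintype.card_fin]) natDegree_map_le,
    hpow, hpow', mul_comm ((-1) ^ k), mul_assoc, mul_left_comm (C c)] at h1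
  have h2 := mul_left_cancel₀ hne h1
  have h3 : eval 1 (reflect Q.natDegree (Q.map (algebraMap ℝ ℂ))) =
      eval 1 (Q.map (algebraMap ℝ ℂ)) := by
    let _ : Invertible (1 : ℂ) := invertibleOne
    have := eval₂_reflect_mul_pow (RingHom.id ℂ) 1 Q.natDegree (Q.map (algebraMap ℝ ℂ))
      natDegree_map_le
    simpa [eval₂_id] using this
  have hQ1' : eval 1 (Q.map (algebraMap ℝ ℂ)) ≠ 0 := by
    rw [eval_one_map]
    exact (_root_.map_ne_zero _).2 hQ1
  have h4 := congrArg (eval 1) h2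
  rw [eval_mul, eval_mul, h3, eval_C] at h4
  have h5 := mul_right_cancel₀ hQ1' h4
  rw [hc, finrank_fixedSubmodule_eq_rootMultiplicity hn hf, ← h5, ← hk]
  simp

end Charpoly

/-! ### Evaluation of `detPoly` at group elements -/

section EvaluateDetPoly

open Polynomial Module

variable {G : Type*} [Group G]

theorem evPoly_detPoly [Finite G] {M : Type*} [AddCommGroup M] [Module ℂ M] [FiniteDimensional ℂ M]
    (ρ : Representation ℂ G M) (g : G) : evPoly g (detPoly ρ) = (ρ g).charpoly := by
  have hpow : ρ g ^ Nat.card G = 1 := by rw [← map_pow, pow_card_eq_one', map_one]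
  rw [← sum_trace_exteriorPower_map Nat.card_pos hpow, detPoly, map_sum]
  refine Finset.sum_congr rfl fun m _ => ?_
  rw [evPoly, coe_mapRingHom, Polynomial.map_mul, Polynomial.map_pow, map_X, map_C, map_mul,
    map_pow, map_neg, map_one]
  rfl

theorem evPoly_detPoly_complexify [Finite G] {M : Type*} [AddCommGroup M]
    [Module ℝ M] [FiniteDimensional ℝ M]
    (ρ : Representation ℝ G M) (g : G) :
    evPoly g (detPoly (complexify ρ)) = (ρ g).charpoly.map (algebraMap ℝ ℂ) := by
  rw [evPoly_detPoly, ← LinearMap.charpoly_baseChange]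
  rfl

theorem evPoly_ext {p q : (RepRing G)[X]} (h : ∀ g, evPoly g p = evPoly g q) : p = q := by
  ext n g
  have := congrArg (fun r => coeff r n) (h g)
  simpa [evPoly, ev] using this

theorem evPoly_map_pullback {H : Type*} [Group H] (η : G →* H) (p : (RepRing H)[X]) (g : G) :
    evPoly g (p.map (pullback η)) = evPoly (η g) p := by
  rw [evPoly, coe_mapRingHom, Polynomial.map_map]
  rfl

end EvaluateDetPoly

/-! ### Evaluation of products in the equivariant incidence algebra -/

section Convolution

open Polynomial

variable {W : Type*} [Group W] {B : Type*} [PartialOrder B] {a : W →* (B ≃o B)}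

/-- The conjugated data are free variables tied by equations, so the lemma applies where `a g z` is
only propositionally equal to `z`. -/
theorem evPoly_conj {p : IncidenceFamily a} (hp : IsEquivariant a p) (g v v' : W) {z x z₁ x₁ : B}
    (h : z ≤ x) (h₁ : z₁ ≤ x₁) (hz : a g z = z₁) (hx : a g x = x₁) (hv : v ∈ stab₂ a z x)
    (hv' : v' ∈ stab₂ a z₁ x₁) (hvv : g * v * g⁻¹ = v') :
    evPoly ⟨v, hv⟩ (p z x h) = evPoly ⟨v', hv'⟩ (p z₁ x₁ h₁) := by
  subst hz hx hvv
  rw [hp g z x h, evPoly_map_pullback]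
  rfl

theorem coeff_inducePoly {G : Type*} [Group G] {H K : Subgroup G} (p : (H → ℂ)[X]) (n : ℕ) :
    (inducePoly K p).coeff n = induce (p.coeff n) := by
  have h0 : induce (0 : H → ℂ) = (0 : K → ℂ) := by
    funext k
    simp [induce]
  rw [inducePoly, Polynomial.sum_def, finsetSum_coeff]
  simp only [coeff_monomial]
  rw [Finset.sum_ite_eq']
  split_ifs with h
  · rfl
  · rw [notMem_support_iff.1 h, h0]

theorem coeff_toFunctions {G : Type*} [Group G] (p : (RepRing G)[X]) (n : ℕ) (g : G) :
    (toFunctions p).coeff n g = (evPoly g p).coeff n := by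
  simp [toFunctions, evPoly, ev]

open Classical in
/-- The contribution of `x` to the value of a product at a group element `k`. -/
def fixedTerm (p q : IncidenceFamily a) {z z' : B} (k : stab₂ a z z') (x : Set.Icc z z') : ℂ[X] :=
  if hx : a (k : W) x = x then
    evPoly (⟨k, k.2.1, hx⟩ : stab₂ a z x) (p z x x.2.1) *
      evPoly (⟨k, hx, k.2.2⟩ : stab₂ a x z') (q x z' x.2.2)
  else 0

/-- The action of the stabilizer of `z` and `z'` on the interval `[z, z']`. -/
def intervalEquiv {z z' : B} (g : stab₂ a z z') : Set.Icc z z' ≃ Set.Icc z z' where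
  toFun x := ⟨a (g : W) x, by
    constructor
    · have h := (a (g : W)).monotone x.2.1
      rwa [show a (g : W) z = z from g.2.1] at h
    · have h := (a (g : W)).monotone x.2.2
      rwa [show a (g : W) z' = z' from g.2.2] at h⟩
  invFun x := ⟨a (g⁻¹ : stab₂ a z z') x, by
    constructor
    · have h := (a ((g⁻¹ : stab₂ a z z') : W)).monotone x.2.1
      rwa [show a ((g⁻¹ : stab₂ a z z') : W) z = z from (g⁻¹).2.1] at h
    · have h := (a ((g⁻¹ : stab₂ a z z') : W)).monotone x.2.2
      rwa [show a ((g⁻¹ : stab₂ a z z') : W) z' = z' from (g⁻¹).2.2] at h⟩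
  left_inv x := Subtype.ext (by simp [← RelIso.mul_apply])
  right_inv x := Subtype.ext (by simp [← RelIso.mul_apply])

open Classical in
-- The conjugate `g⁻¹ k g` fixes `x` if and only if `k` fixes `g x`, and equivariance moves the
-- values from `x` to `g x`.
theorem fixedTerm_intervalEquiv {p q : IncidenceFamily a} (hp : IsEquivariant a p)
    (hq : IsEquivariant a q) {z z' : B} (k g : stab₂ a z z') (x : Set.Icc z z') (n : ℕ) :
    (if h : (g : W)⁻¹ * k * g ∈ stab₃ a z x z' then
      (toFunctions ((p z x x.2.1).map (pullback (Subgroup.inclusion (stab₃_le_left a z x z'))) *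
        (q x z' x.2.2).map (pullback (Subgroup.inclusion (stab₃_le_right a z x z'))))).coeff n
          ⟨(g : W)⁻¹ * k * g, h⟩ else 0) =
      (fixedTerm p q k (intervalEquiv g x)).coeff n := by
  have hconj : (g : W) * ((g : W)⁻¹ * k * g) * (g : W)⁻¹ = k := by group
  have hiff : (g : W)⁻¹ * k * g ∈ stab₃ a z x z' ↔
      a (k : W) (intervalEquiv g x) = intervalEquiv g x := by
    have h1 : (g : W)⁻¹ * k * g ∈ stab₂ a z z' := (g⁻¹ * k * g).2
    have h2 : (g : W)⁻¹ * k * g ∈ stab₃ a z x z' ↔ a ((g : W)⁻¹ * k * g) x = x :=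
      ⟨fun h => h.1.2, fun h => ⟨⟨h1.1, h⟩, h1.2⟩⟩
    rw [h2]
    change _ ↔ a (k : W) (a (g : W) x) = a (g : W) x
    rw [← (a (g : W)).injective.eq_iff, ← RelIso.mul_apply, ← RelIso.mul_apply, ← map_mul,
      ← map_mul]
    have h3 : (g : W) * ((g : W)⁻¹ * k * g) = k * g := by group
    rw [h3]
  by_cases h : (g : W)⁻¹ * k * g ∈ stab₃ a z x z'
  · have h' := hiff.1 h
    rw [dif_pos h, fixedTerm, dif_pos h', coeff_toFunctions, map_mul, evPoly_map_pullback,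
      evPoly_map_pullback]
    congr 2
    · exact evPoly_conj hp g _ _ _ _ g.2.1 rfl _ _ hconj
    · exact evPoly_conj hq g _ _ _ _ rfl g.2.2 _ _ hconj
  · rw [dif_neg h, fixedTerm, dif_neg fun h' => h (hiff.2 h'), coeff_zero]

/-- The factor `1 / |stab₃|` of induction cancels the numerator of the weight. What remains is the
average over `g` of the sums of `fixedTerm` at `g x`, and each of these sums is the same because `g`
permutes the interval. -/
theorem coeff_convolution [Finite W] {p q : IncidenceFamily a} (hp : IsEquivariant a p)
    (hq : IsEquivariant a q) {z z' : B} [Fintype (Set.Icc z z')] (n : ℕ) (k : stab₂ a z z') :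
    (convolution a p q z z').coeff n k = ∑ x : Set.Icc z z', (fixedTerm p q k x).coeff n := by
  classical
  have := Fintype.ofFinite (stab₂ a z z')
  rw [convolution, finsum_eq_sum_of_fintype, finsetSum_coeff, Finset.sum_apply]
  have hK : (Nat.card (stab₂ a z z') : ℂ) ≠ 0 := Nat.cast_ne_zero.2 Nat.card_pos.ne'
  have hterm : ∀ x : Set.Icc z z', (((Nat.card (stab₃ a z x z') : ℂ) /
      (Nat.card (stab₂ a z z') : ℂ)) • inducePoly (stab₂ a z z') (toFunctions
        ((p z x x.2.1).map (pullback (Subgroup.inclusion (stab₃_le_left a z x z'))) *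
          (q x z' x.2.2).map
            (pullback (Subgroup.inclusion (stab₃_le_right a z x z')))))).coeff n k =
      (Nat.card (stab₂ a z z') : ℂ)⁻¹ *
        ∑ g : stab₂ a z z', (fixedTerm p q k (intervalEquiv g x)).coeff n := by
    intro x
    have hH : (Nat.card (stab₃ a z x z') : ℂ) ≠ 0 := Nat.cast_ne_zero.2 Nat.card_pos.ne'
    rw [coeff_smul, Pi.smul_apply, coeff_inducePoly, induce, finsum_eq_sum_of_fintype, smul_eq_mul,
      ← mul_assoc]
    congr 1
    · field_simp
    · exact Finset.sum_congr rfl fun g _ => fixedTerm_intervalEquiv hp hq k g x n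
  simp_rw [hterm]
  rw [← Finset.mul_sum, Finset.sum_comm]
  have hg : ∀ g : stab₂ a z z', ∑ x, (fixedTerm p q k (intervalEquiv g x)).coeff n =
      ∑ x, (fixedTerm p q k x).coeff n := fun g =>
    Equiv.sum_comp (intervalEquiv g) fun x => (fixedTerm p q k x).coeff n
  simp_rw [hg]
  rw [Finset.sum_const, Finset.card_univ, ← Nat.card_eq_fintype_card, nsmul_eq_mul,
    inv_mul_cancel_left₀ hK]

end Convolution

theorem evPoly_ite_mul_detPoly {G M : Type*} [Group G] [Finite G] [AddCommGroup M] [Module ℝ M]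
    [FiniteDimensional ℝ M] (c : Prop) [Decidable c] (ρ : Representation ℝ G M) (g : G) :
    evPoly g ((if c then Polynomial.X - 1 else 1) * detPoly (complexify ρ)) =
      (if c then Polynomial.X - 1 else 1) * (ρ g).charpoly.map (algebraMap ℝ ℂ) := by
  rw [map_mul, evPoly_detPoly_complexify]
  congr 1
  split_ifs
  · rw [evPoly, Polynomial.coe_mapRingHom, Polynomial.map_sub, Polynomial.map_X,
      Polynomial.map_one]
  · exact map_one _

/-! ### The kernel of an equivariant morphism of fans -/

namespace EquivariantFanMorphism

open Polynomial Module

variable {W V' V : Type*} [Group W] [AddCommGroup V'] [Module ℝ V'] [AddCommGroup V] [Module ℝ V]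
  (D : EquivariantFanMorphism W V' V)

theorem coneSpan_mono : Monotone D.coneSpan := fun _ _ h => Submodule.span_mono (D.cone_mono h)

theorem map_mem_coneSpan_action (w : W) (z : D.Γ) {v : V'} (hv : v ∈ D.coneSpan z) :
    D.ψ' w v ∈ D.coneSpan (D.action w z) := by
  have h : D.coneSpan z ≤ (D.coneSpan (D.action w z)).comap (D.ψ' w) :=
    Submodule.span_le.2 fun v hv => Submodule.subset_span (D.mem_cone_action w z hv)
  exact h hv

theorem action_inv_action (w : W) (z : D.Γ) : D.action w⁻¹ (D.action w z) = z := by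
  rw [← RelIso.mul_apply, ← map_mul, inv_mul_cancel, map_one, RelIso.one_apply]

/-- An element of `W` maps the span of a cone isomorphically onto the span of its image. -/
def coneSpanEquiv (w : W) (z : D.Γ) : D.coneSpan z ≃ₗ[ℝ] D.coneSpan (D.action w z) where
  toFun v := ⟨D.ψ' w v, D.map_mem_coneSpan_action w z v.2⟩
  map_add' u v := Subtype.ext (map_add _ _ _)
  map_smul' c v := Subtype.ext (map_smul _ _ _)
  invFun v := ⟨D.ψ' w⁻¹ v, by
    have h := D.map_mem_coneSpan_action w⁻¹ _ v.2
    rwa [action_inv_action] at h⟩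
  left_inv v := Subtype.ext (by simp)
  right_inv v := Subtype.ext (by simp)

theorem action_mem_upperPart_iff (w : W) (z : D.Γ) :
    D.action w z ∈ D.upperPart ↔ z ∈ D.upperPart := by
  refine ⟨fun h => ?_, D.action_mem_upperPart w z⟩
  rw [← D.action_inv_action w z]
  exact D.action_mem_upperPart _ _ h

theorem coneRank_action (w : W) (z : D.Γ) :
    coneRank D.upperPart D.cone (D.action w z) = coneRank D.upperPart D.cone z := by
  have h : finrank ℝ (D.coneSpan z) = finrank ℝ (D.coneSpan (D.action w z)) :=
    (D.coneSpanEquiv w z).finrank_eq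
  classical
  exact congrArg₂ (· + ·) h.symm (if_congr (D.action_mem_upperPart_iff w z) rfl rfl)

/-- The endomorphism of the span of a cone that is induced by a group element fixing the cone. -/
def spanEnd (w : W) (z : FixedPoset D.action w) : End ℝ (D.coneSpan z.1) :=
  (D.ψ' w).restrict (D.coneSpan_le_comap w z.1 z.2)

/-- The system of cones in the fixed subspace of a group element. -/
def fixedCone (w : W) (z : FixedPoset D.action w) : PointedCone ℝ (fixedSubmodule (D.ψ' w)) :=
  (D.cone z.1).comap (fixedSubmodule (D.ψ' w)).subtype

/-- The fixed points of the upper part. -/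
def fixedUpperPart (w : W) : Set (FixedPoset D.action w) := {z | z.1 ∈ D.upperPart}

theorem rep_pow_card [Finite W] (w : W) : D.ψ' w ^ Nat.card W = 1 := by
  rw [← map_pow, pow_card_eq_one', map_one]

theorem isConeSystem_fixedCone [Finite W] (hproper : D.source.IsProper D.target D.φ)
    (hsurj : Function.Surjective D.φ) (w : W) :
    IsConeSystem (D.fixedUpperPart w) (D.fixedCone w) :=
  (D.isConeSystem hproper hsurj).fixed (D.action w) (D.ψ' w) Nat.card_pos (D.rep_pow_card w)
    (fun z _ hv => D.mem_cone_action w z hv) (D.action_mem_upperPart w)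

/-- This links the rank in the fixed poset to the sign in the reversal of the characteristic
polynomial. -/
theorem finrank_span_fixedCone [Finite W] (hproper : D.source.IsProper D.target D.φ)
    (hsurj : Function.Surjective D.φ) (w : W) (z : FixedPoset D.action w) :
    finrank ℝ (Submodule.span ℝ (D.fixedCone w z : Set (fixedSubmodule (D.ψ' w)))) =
      finrank ℝ (fixedSubmodule (D.spanEnd w z)) := by
  have h1 : Submodule.span ℝ (D.fixedCone w z : Set (fixedSubmodule (D.ψ' w))) =
      (D.coneSpan z.1).comap (fixedSubmodule (D.ψ' w)).subtype :=
    span_fixed ((D.isConeSystem hproper hsurj).polyhedral z.1) Nat.card_pos (D.rep_pow_card w)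
      fun v hv => by
        have h := D.mem_cone_action w z.1 hv
        rwa [z.2] at h
  rw [h1, ← Submodule.finrank_map_subtype_eq, ← Submodule.finrank_map_subtype_eq]
  suffices h : ((D.coneSpan z.1).comap (fixedSubmodule (D.ψ' w)).subtype).map
      (fixedSubmodule (D.ψ' w)).subtype =
      (fixedSubmodule (D.spanEnd w z)).map (D.coneSpan z.1).subtype by rw [h]
  rw [Submodule.map_comap_subtype]
  ext v
  constructor
  · rintro ⟨hv, hv'⟩
    exact ⟨⟨v, hv'⟩, Subtype.ext hv, rfl⟩
  · rintro ⟨u, hu, rfl⟩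
    exact ⟨congrArg Subtype.val hu, u.2⟩

variable [FiniteDimensional ℝ V']

open Classical in
/-- The characteristic polynomial of `spanEnd`, multiplied by `t - 1` on the upper part. -/
def spanPoly (w : W) (z : FixedPoset D.action w) : ℂ[X] :=
  (if z.1 ∈ D.upperPart then X - 1 else 1) * (D.spanEnd w z).charpoly.map (algebraMap ℝ ℂ)

theorem monic_spanPoly (w : W) (z : FixedPoset D.action w) : (D.spanPoly w z).Monic := by
  refine Monic.mul ?_ ((LinearMap.charpoly_monic _).map _)
  split_ifs
  · exact monic_X_sub_C (1 : ℂ)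
  · exact monic_one

theorem natDegree_spanPoly (w : W) (z : FixedPoset D.action w) :
    (D.spanPoly w z).natDegree = coneRank D.upperPart D.cone z.1 := by
  have h : ((D.spanEnd w z).charpoly.map (algebraMap ℝ ℂ)).natDegree =
      finrank ℝ (Submodule.span ℝ (D.cone z.1 : Set V')) := by
    rw [natDegree_map]
    exact LinearMap.charpoly_natDegree _
  rw [spanPoly, coneRank, add_comm]
  split_ifs with hz
  · have hX : (X - 1 : ℂ[X]).Monic := monic_X_sub_C (1 : ℂ)
    have hX' : (X - 1 : ℂ[X]).natDegree = 1 := natDegree_X_sub_C (1 : ℂ)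
    rw [hX.natDegree_mul ((LinearMap.charpoly_monic _).map _), h, hX']
  · rw [one_mul, h, zero_add]

theorem kappa_eq (z z' : D.Γ) (h : z ≤ z') [Decidable (z ∉ D.upperPart ∧ z' ∈ D.upperPart)] :
    D.kappa z z' h = (if z ∉ D.upperPart ∧ z' ∈ D.upperPart then X - 1 else 1) *
      detPoly (complexify (D.quotRep z z')) := by
  cases z with
  | inX x =>
    cases z' with
    | inX x' =>
      rw [if_neg fun h => D.inX_notMem_upperPart x' h.2, one_mul]; rfl
    | inY y' =>
      rw [if_pos ⟨D.inX_notMem_upperPart x, D.inY_mem_upperPart y'⟩]; rfl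
  | inY y =>
    rw [if_neg fun h => h.1 (D.inY_mem_upperPart y), one_mul]
    cases z' <;> rfl

theorem charpoly_quotRep_mul (w : W) (z z' : FixedPoset D.action w) (h : z ≤ z') :
    (D.quotRep z.1 z'.1 ⟨w, z.2, z'.2⟩).charpoly * (D.spanEnd w z).charpoly =
      (D.spanEnd w z').charpoly := by
  have hle : D.coneSpan z.1 ≤ D.coneSpan z'.1 := D.coneSpan_mono h
  have hst : (D.coneSpan z.1).submoduleOf (D.coneSpan z'.1) ≤
      ((D.coneSpan z.1).submoduleOf (D.coneSpan z'.1)).comap (D.spanEnd w z') := fun v hv => by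
    have hv' : (v : V') ∈ D.coneSpan z.1 := hv
    exact D.coneSpan_le_comap w z.1 z.2 hv'
  have h1 := LinearMap.charpoly_eq_restrict_mul_mapQ _ (D.spanEnd w z') hst
  have h2 : D.spanEnd w z =
      (Submodule.submoduleOfEquivOfLe hle).conj (LinearMap.restrict (D.spanEnd w z') hst) :=
    LinearMap.ext fun v => Subtype.ext rfl
  have h3 : D.quotRep z.1 z'.1 ⟨w, z.2, z'.2⟩ = Submodule.mapQ _ _ (D.spanEnd w z') hst := rfl
  rw [h2, LinearEquiv.charpoly_conj, h3, h1, mul_comm]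

theorem evFamily_kappa [Finite W] (w : W) (z z' : FixedPoset D.action w) (h : z ≤ z')
    [Decidable (z.1 ∉ D.upperPart ∧ z'.1 ∈ D.upperPart)] :
    evFamily D.action w D.kappa z z' h =
      (if z.1 ∉ D.upperPart ∧ z'.1 ∈ D.upperPart then X - 1 else 1) *
        (D.quotRep z.1 z'.1 ⟨w, z.2, z'.2⟩).charpoly.map (algebraMap ℝ ℂ) :=
  (congrArg (evPoly _) (D.kappa_eq z.1 z'.1 h)).trans
    (evPoly_ite_mul_detPoly _ (D.quotRep z.1 z'.1) ⟨w, z.2, z'.2⟩)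

/-- `kappa` is a quotient of values of the one-variable function `spanPoly`. As `spanPoly` is monic
it can be cancelled, so the properties of `kappa` follow from those of `spanPoly`. -/
theorem evFamily_kappa_mul [Finite W] (w : W) (z z' : FixedPoset D.action w) (h : z ≤ z') :
    evFamily D.action w D.kappa z z' h * D.spanPoly w z = D.spanPoly w z' := by
  classical
  have hs : ∀ z, D.spanPoly w z = (if z.1 ∈ D.upperPart then X - 1 else 1) *
    (D.spanEnd w z).charpoly.map (algebraMap ℝ ℂ) := fun z => rfl
  have hq := congrArg (Polynomial.map (algebraMap ℝ ℂ)) (D.charpoly_quotRep_mul w z z' h)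
  rw [Polynomial.map_mul] at hq
  rw [D.evFamily_kappa w z z' h]
  generalize (D.quotRep z.1 z'.1 ⟨w, z.2, z'.2⟩).charpoly = p at hq ⊢
  rw [hs, hs, ← hq]
  by_cases hz : z.1 ∈ D.upperPart
  · have hz' : z'.1 ∈ D.upperPart := D.upperPart_isUpperSet h hz
    rw [if_neg fun h => h.1 hz, if_pos hz, if_pos hz']
    ring
  · by_cases hz' : z'.1 ∈ D.upperPart
    · rw [if_pos ⟨hz, hz'⟩, if_neg hz, if_pos hz']
      ring
    · rw [if_neg fun h => hz' h.2, if_neg hz, if_neg hz']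
      ring

theorem spanPoly_conj (w v : W) (z : FixedPoset D.action v) (z₁ : FixedPoset D.action (w * v * w⁻¹))
    (h : z₁.1 = D.action w z.1) : D.spanPoly (w * v * w⁻¹) z₁ = D.spanPoly v z := by
  obtain ⟨z₁, hz₁⟩ := z₁
  obtain rfl : z₁ = D.action w z.1 := h
  have h1 : D.spanEnd (w * v * w⁻¹) ⟨_, hz₁⟩ = (D.coneSpanEquiv w z.1).conj (D.spanEnd v z) := by
    ext u
    change D.ψ' (w * v * w⁻¹) u = D.ψ' w (D.ψ' v (D.ψ' w⁻¹ u))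
    simp only [map_mul, Module.End.mul_apply]
  rw [spanPoly, spanPoly, h1, LinearEquiv.charpoly_conj]
  classical
  exact congrArg (· * _) (if_congr (D.action_mem_upperPart_iff w z.1) rfl rfl)

theorem isEquivariant_kappa [Finite W] : IsEquivariant D.action D.kappa := by
  intro w z z' h
  refine evPoly_ext fun v => ?_
  rw [evPoly_map_pullback]
  have hz : D.action (v : W) z = z := v.2.1
  have hz' : D.action (v : W) z' = z' := v.2.2
  have h1 := D.evFamily_kappa_mul v ⟨z, hz⟩ ⟨z', hz'⟩ h
  have h2 := D.evFamily_kappa_mul (w * v * w⁻¹) ⟨D.action w z, conj_mem_stab D.action w v.2.1⟩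
    ⟨D.action w z', conj_mem_stab D.action w v.2.2⟩ ((D.action w).monotone h)
  rw [D.spanPoly_conj w v ⟨z, hz⟩ _ rfl, D.spanPoly_conj w v ⟨z', hz'⟩ _ rfl, ← h1] at h2
  exact (mul_right_cancel₀ (D.monic_spanPoly v ⟨z, hz⟩).ne_zero h2).symm

theorem isUnital_kappa [Finite W] : IsUnital D.action D.kappa := by
  intro z
  refine evPoly_ext fun v => ?_
  have hz : D.action (v : W) z = z := v.2.1
  have h1 := D.evFamily_kappa_mul v ⟨z, hz⟩ ⟨z, hz⟩ le_rfl
  rw [map_one]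
  exact mul_right_cancel₀ (D.monic_spanPoly v ⟨z, hz⟩).ne_zero (h1.trans (one_mul _).symm)

theorem isMultiplicative_kappa [Finite W] : IsMultiplicative D.action D.kappa := by
  intro w z z'' z' h h'
  refine mul_right_cancel₀ (D.monic_spanPoly w z).ne_zero ?_
  rw [evFamily_kappa_mul, mul_right_comm, evFamily_kappa_mul, mul_comm, evFamily_kappa_mul]

theorem natDegree_evFamily_kappa [Finite W] (w : W) (z z' : FixedPoset D.action w) (h : z ≤ z') :
    (evFamily D.action w D.kappa z z' h).natDegree + coneRank D.upperPart D.cone z.1 =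
      coneRank D.upperPart D.cone z'.1 := by
  have h1 := D.evFamily_kappa_mul w z z' h
  have h2 : evFamily D.action w D.kappa z z' h ≠ 0 := fun h0 => by
    rw [h0, zero_mul] at h1
    exact (D.monic_spanPoly w z').ne_zero h1.symm
  rw [← natDegree_spanPoly, ← natDegree_spanPoly, ← h1,
    natDegree_mul h2 (D.monic_spanPoly w z).ne_zero]

/-- On the upper part the factor `X - 1` raises the degree by one and changes sign under reversal,
matching the extra one in both ranks. -/
theorem reflect_spanPoly [Finite W] (hproper : D.source.IsProper D.target D.φ)
    (hsurj : Function.Surjective D.φ) (w : W) (z : FixedPoset D.action w) :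
    reflect (coneRank D.upperPart D.cone z.1) (D.spanPoly w z) =
      (-1) ^ coneRank (D.fixedUpperPart w) (D.fixedCone w) z * D.spanPoly w z := by
  have hpow : D.spanEnd w z ^ Nat.card W = 1 := by
    have h1 : ∀ k : ℕ, ∀ u, ((D.spanEnd w z ^ k) u : V') = (D.ψ' w ^ k) u := by
      intro k
      induction k with
      | zero => intro u; rfl
      | succ k ih => intro u; rw [pow_succ, pow_succ, End.mul_apply, End.mul_apply, ih]; rfl
    refine LinearMap.ext fun u => Subtype.ext ?_
    rw [h1, D.rep_pow_card]
    rfl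
  have h := reflect_charpoly_of_pow_eq_one Nat.card_pos hpow
  rw [← D.finrank_span_fixedCone hproper hsurj] at h
  rw [spanPoly, coneRank, coneRank]
  by_cases hz : z.1 ∈ D.upperPart
  · have hz' : z ∈ D.fixedUpperPart w := hz
    have hle : (map (algebraMap ℝ ℂ) (D.spanEnd w z).charpoly).natDegree ≤
        finrank ℝ (Submodule.span ℝ (D.cone z.1 : Set V')) := by
      rw [natDegree_map]
      exact (LinearMap.charpoly_natDegree _).le
    have hX : (X - 1 : ℂ[X]).natDegree ≤ 1 := natDegree_X_sub_C_le (1 : ℂ)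
    rw [if_pos hz, if_pos hz, if_pos hz', add_comm, reflect_mul _ _ hX hle, pow_succ]
    have h1 : reflect 1 (X - 1 : ℂ[X]) = -(X - 1) := by
      rw [reflect_sub, reflect_one_X, reflect_one, pow_one, neg_sub]
    rw [h1]
    exact (congrArg _ h).trans (by ring)
  · have hz' : z ∉ D.fixedUpperPart w := hz
    rw [if_neg hz, if_neg hz, if_neg hz', add_zero, add_zero, one_mul]
    exact h

end EquivariantFanMorphism

/-! ### Rank functions and kernels -/

section Incidence

open Polynomial

variable {W : Type*} [Group W] {B : Type*} [PartialOrder B] {a : W →* (B ≃o B)}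

theorem IsRankFunction.strictMono [Finite B] {ρ : B → ℤ} (hρ : IsRankFunction ρ) : StrictMono ρ :=
  fun z _ h => covBy_induction (P := fun z z' => z ≠ z' → ρ z < ρ z') (fun _ h => (h rfl).elim)
    (fun _ _ _ h1 _ h2 _ => by
      have h3 := hρ.monotone h1
      rw [hρ _ _ h2]
      lia) h.le h.ne

theorem isWeakRankFunction_naturalRank [Finite B] {ρ : B → ℕ}
    (hρ : IsRankFunction fun z => (ρ z : ℤ)) : IsWeakRankFunction (naturalRank (B := B)) where
  pos z z' h := by
    have h1 := naturalRank_add hρ h.le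
    have h2 : ρ z < ρ z' := by exact_mod_cast hρ.strictMono h
    lia
  add z z'' z' h h' := by
    have h1 := naturalRank_add hρ h
    have h2 := naturalRank_add hρ h'
    have h3 := naturalRank_add hρ (h.trans h')
    lia

theorem IsEquivariant.revFamily {p : IncidenceFamily a} (hp : IsEquivariant a p) {r : B → B → ℕ}
    (hr : IsInvariantRank a r) : IsEquivariant a (revFamily a r p) := fun w z z' h => by
  change reflect (r z z') (p z z' h) = (reflect (r (a w z) (a w z')) (p _ _ _)).map _
  rw [hr w z z' h, ← reflect_map, ← hp w z z' h]

theorem evPoly_reflect {G : Type*} [Group G] (g : G) (p : (RepRing G)[X]) (n : ℕ) :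
    evPoly g (p.reflect n) = (evPoly g p).reflect n :=
  (reflect_map _ _ _).symm

theorem degree_le_of_natDegree_evPoly_le {G : Type*} [Group G] {p : (RepRing G)[X]} {n : ℕ}
    (h : ∀ g, (evPoly g p).natDegree ≤ n) : p.degree ≤ n := by
  refine (degree_le_iff_coeff_zero _ _).2 fun m hm => Subtype.ext (funext fun g => ?_)
  have h1 : (evPoly g p).coeff m = 0 :=
    coeff_eq_zero_of_natDegree_lt ((h g).trans_lt (WithBot.coe_lt_coe.1 hm))
  rwa [evPoly, coe_mapRingHom, coeff_map] at h1

theorem convolution_eq_of_sum_fixedTerm [Finite W] {p q : IncidenceFamily a}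
    (hp : IsEquivariant a p) (hq : IsEquivariant a q) {z z' : B} [Fintype (Set.Icc z z')]
    {f : (RepRing (stab₂ a z z'))[X]} (h : ∀ k, ∑ x, fixedTerm p q k x = evPoly k f) :
    convolution a p q z z' = toFunctions f := by
  refine Polynomial.ext fun n => funext fun k => ?_
  rw [coeff_convolution hp hq, coeff_toFunctions, ← h, finsetSum_coeff]

theorem IsConeSystem.sum_Icc_subtype {U : Type*} [AddCommGroup U] [Module ℝ U]
    [FiniteDimensional ℝ U] [Finite B] {up : Set B} {c : B → PointedCone ℝ U}
    (hc : IsConeSystem up c) {z z' : B} [Fintype (Set.Icc z z')] (h : z < z') :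
    ∑ i : Set.Icc z z', (-1 : ℤ) ^ coneRank up c i = 0 := by
  classical
  have := Fintype.ofFinite B
  rw [← hc.sum_Icc h]
  refine (Finset.sum_subtype _ (fun x => ?_) fun i => (-1 : ℤ) ^ coneRank up c i).symm
  simp [Set.mem_Icc]

/-- Only the elements fixed by `k` contribute, so this is a signed sum over an interval of the fixed
poset, where the Eulerian relation applies. -/
theorem IsConeSystem.sum_fixedTerm {U : Type*} [AddCommGroup U] [Module ℝ U]
    [FiniteDimensional ℝ U] [Finite B] {p q : IncidenceFamily a} {z z' : B}
    [Fintype (Set.Icc z z')] (k : stab₂ a z z') {up : Set (FixedPoset a (k : W))}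
    {c : FixedPoset a (k : W) → PointedCone ℝ U} (hc : IsConeSystem up c) (h : z < z') {b : ℂ[X]}
    (hterm : ∀ (x : Set.Icc z z') (hx : a (k : W) x = x),
      fixedTerm p q k x = (-1) ^ coneRank up c ⟨x, hx⟩ * b) :
    ∑ x, fixedTerm p q k x = 0 := by
  classical
  let y : FixedPoset a (k : W) := ⟨z, k.2.1⟩
  let y' : FixedPoset a (k : W) := ⟨z', k.2.2⟩
  have := Fintype.ofFinite (Set.Icc y y')
  let e : Set.Icc y y' → Set.Icc z z' := fun i => ⟨i.1.1, i.2.1, i.2.2⟩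
  have he : Function.Injective e := fun i j hij => by
    have h0 : i.1.1 = j.1.1 := congrArg (fun x : Set.Icc z z' => (x : B)) hij
    exact Subtype.ext (Subtype.ext h0)
  have hout : ∀ x, x ∉ Set.range e → fixedTerm p q k x = 0 := fun x hx => by
    rw [fixedTerm, dif_neg]
    exact fun h0 => hx ⟨⟨⟨x, h0⟩, x.2.1, x.2.2⟩, rfl⟩
  have hin : ∀ i : Set.Icc y y', fixedTerm p q k (e i) = (-1) ^ coneRank up c i * b :=
    fun i => hterm (e i) i.1.2
  have h1 : ∑ i : Set.Icc y y', (-1 : ℂ[X]) ^ coneRank up c i * b = ∑ x, fixedTerm p q k x :=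
    Fintype.sum_of_injective e he _ _ hout fun i => (hin i).symm
  have h2 : ((∑ i : Set.Icc y y', (-1 : ℤ) ^ coneRank up c i : ℤ) : ℂ[X]) = 0 := by
    rw [hc.sum_Icc_subtype (show y < y' from h), Int.cast_zero]
  rw [← h1, ← Finset.sum_mul]
  push_cast at h2
  rw [h2, zero_mul]

theorem sum_fixedTerm_eq_one {p q : IncidenceFamily a} {z : B}
    [Fintype (Set.Icc z z)] (k : stab₂ a z z)
    (h : ∀ hz, fixedTerm p q k ⟨z, hz⟩ = 1) : ∑ x, fixedTerm p q k x = 1 := by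
  have hz : z ∈ Set.Icc z z := ⟨le_rfl, le_rfl⟩
  rw [Fintype.sum_eq_single ⟨z, hz⟩ fun x hx =>
    (hx (Subtype.ext (le_antisymm x.2.2 x.2.1))).elim, h]

theorem neg_one_pow_eq {m i j : ℕ} (h : m + i = j) : (-1 : ℂ[X]) ^ m = (-1) ^ i * (-1) ^ j := by
  rw [← h, ← pow_add, show i + (m + i) = m + 2 * i by ring, pow_add, pow_mul, neg_one_sq, one_pow,
    mul_one]

end Incidence

/-! ### The Eulerian action and the kernel identities -/

namespace EquivariantFanMorphism

open Polynomial Module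

variable {W V' V : Type*} [Group W] [AddCommGroup V'] [Module ℝ V'] [AddCommGroup V] [Module ℝ V]
  (D : EquivariantFanMorphism W V' V)

/-- The origin is fixed by `w`, so a cone with the origin in its relative interior is fixed. -/
theorem nonempty_fixedPoset (hproper : D.source.IsProper D.target D.φ)
    (hsurj : Function.Surjective D.φ) (w : W) :
    Nonempty (FixedPoset D.action w) := by
  have hc := D.isConeSystem hproper hsurj
  obtain ⟨z₁⟩ : Nonempty D.Γ := inferInstance
  obtain ⟨z, -, -, h⟩ := hc.exists_mem z₁ 0 (D.cone z₁).zero_mem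
  exact ⟨⟨z, hc.map_eq_of_mem_relInterior (D.action w) (D.ψ' w)
    (fun z _ hv => D.mem_cone_action w z hv) (D.action_mem_upperPart w) h (map_zero _)⟩⟩

variable [FiniteDimensional ℝ V']

theorem naturalRank_add_coneRank (hproper : D.source.IsProper D.target D.φ)
    (hsurj : Function.Surjective D.φ) {z z' : D.Γ} (h : z ≤ z') :
    naturalRank z z' + coneRank D.upperPart D.cone z = coneRank D.upperPart D.cone z' :=
  naturalRank_add (D.isConeSystem hproper hsurj).isRankFunction h

theorem isInvariantRank_naturalRank (hproper : D.source.IsProper D.target D.φ)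
    (hsurj : Function.Surjective D.φ) : IsInvariantRank D.action (naturalRank (B := D.Γ)) := by
  intro w z z' h
  have h1 := D.naturalRank_add_coneRank hproper hsurj h
  have h2 := D.naturalRank_add_coneRank hproper hsurj ((D.action w).monotone h)
  rw [D.coneRank_action, D.coneRank_action] at h2
  lia

variable [Finite W]

theorem isEulerianAction (hproper : D.source.IsProper D.target D.φ)
    (hsurj : Function.Surjective D.φ) : IsEulerianAction D.action := by
  refine ⟨(D.isConeSystem hproper hsurj).isLowerEulerian, fun w => ?_⟩
  have := D.nonempty_fixedPoset hproper hsurj w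
  exact (D.isConeSystem_fixedCone hproper hsurj w).isLowerEulerian

theorem naturalRank_add_coneRank_fixed (hproper : D.source.IsProper D.target D.φ)
    (hsurj : Function.Surjective D.φ) (w : W) {z z' : FixedPoset D.action w} (h : z ≤ z') :
    naturalRank z z' + coneRank (D.fixedUpperPart w) (D.fixedCone w) z =
      coneRank (D.fixedUpperPart w) (D.fixedCone w) z' :=
  naturalRank_add (D.isConeSystem_fixedCone hproper hsurj w).isRankFunction h

theorem natDegree_evFamily_kappa_eq_naturalRank (hproper : D.source.IsProper D.target D.φ)
    (hsurj : Function.Surjective D.φ) (w : W) (z z' : FixedPoset D.action w) (h : z ≤ z') :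
    (evFamily D.action w D.kappa z z' h).natDegree = naturalRank z.1 z'.1 := by
  have h1 := D.naturalRank_add_coneRank hproper hsurj (show z.1 ≤ z'.1 from h)
  have h2 := D.natDegree_evFamily_kappa w z z' h
  lia

theorem isBounded_kappa (hproper : D.source.IsProper D.target D.φ)
    (hsurj : Function.Surjective D.φ) :
    IsBounded D.action (naturalRank (B := D.Γ)) D.kappa :=
  ⟨D.isEquivariant_kappa, fun z z' h => degree_le_of_natDegree_evPoly_le fun g =>
    (D.natDegree_evFamily_kappa_eq_naturalRank hproper hsurj g ⟨z, g.2.1⟩ ⟨z', g.2.2⟩ h).le⟩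

/-- Reverse both sides of `evFamily_kappa_mul` and cancel `spanPoly`; the quotient of the two signs
is the sign of the rank difference in the fixed poset. -/
theorem isRankAlternating_kappa (hproper : D.source.IsProper D.target D.φ)
    (hsurj : Function.Surjective D.φ) :
    IsRankAlternating D.action (naturalRank (B := D.Γ)) D.kappa := by
  intro w z z' h
  have h1 : evFamily D.action w (revFamily D.action naturalRank D.kappa) z z' h =
      reflect (naturalRank z.1 z'.1) (evFamily D.action w D.kappa z z' h) := evPoly_reflect _ _ _
  have h2 := congrArg (reflect (naturalRank z.1 z'.1 + coneRank D.upperPart D.cone z.1))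
    (D.evFamily_kappa_mul w z z' h)
  rw [reflect_mul _ _ (D.natDegree_evFamily_kappa_eq_naturalRank hproper hsurj w z z' h).le
    (D.natDegree_spanPoly w z).le, D.naturalRank_add_coneRank hproper hsurj h,
    D.reflect_spanPoly hproper hsurj, D.reflect_spanPoly hproper hsurj,
    ← D.naturalRank_add_coneRank_fixed hproper hsurj w h, ← D.evFamily_kappa_mul w z z' h] at h2
  rw [h1]
  have h3 : ((-1 : ℂ[X]) ^ coneRank (D.fixedUpperPart w) (D.fixedCone w) z *
      D.spanPoly w z) ≠ 0 :=
    mul_ne_zero (pow_ne_zero _ (neg_ne_zero.2 one_ne_zero)) (D.monic_spanPoly w z).ne_zero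
  refine mul_right_cancel₀ h3 (h2.trans ?_)
  rw [pow_add]
  ring

/-- Rank alternation turns the reversed factor into a sign, and multiplicativity merges the two
factors. Only the sign depends on `x`. -/
theorem fixedTerm_kappa_rev (hproper : D.source.IsProper D.target D.φ)
    (hsurj : Function.Surjective D.φ) {z z' : D.Γ} (h : z ≤ z') (k : stab₂ D.action z z')
    (x : Set.Icc z z') (hx : D.action (k : W) x = x) :
    fixedTerm D.kappa (revFamily D.action naturalRank D.kappa) k x =
      (-1) ^ naturalRank (B := FixedPoset D.action (k : W)) ⟨x, hx⟩ ⟨z', k.2.2⟩ *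
        evPoly k (D.kappa z z' h) := by
  have h1 := D.isRankAlternating_kappa hproper hsurj k ⟨x, hx⟩ ⟨z', k.2.2⟩ x.2.2
  have h2 := D.isMultiplicative_kappa k ⟨z, k.2.1⟩ ⟨x, hx⟩ ⟨z', k.2.2⟩ x.2.1 x.2.2
  rw [fixedTerm, dif_pos hx]
  refine (congrArg (_ * ·) h1).trans ?_
  rw [mul_left_comm]
  exact congrArg (_ * ·) h2.symm

theorem fixedTerm_rev_kappa (hproper : D.source.IsProper D.target D.φ)
    (hsurj : Function.Surjective D.φ) {z z' : D.Γ} (h : z ≤ z') (k : stab₂ D.action z z')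
    (x : Set.Icc z z') (hx : D.action (k : W) x = x) :
    fixedTerm (revFamily D.action naturalRank D.kappa) D.kappa k x =
      (-1) ^ naturalRank (B := FixedPoset D.action (k : W)) ⟨z, k.2.1⟩ ⟨x, hx⟩ *
        evPoly k (D.kappa z z' h) := by
  have h1 := D.isRankAlternating_kappa hproper hsurj k ⟨z, k.2.1⟩ ⟨x, hx⟩ x.2.1
  have h2 := D.isMultiplicative_kappa k ⟨z, k.2.1⟩ ⟨x, hx⟩ ⟨z', k.2.2⟩ x.2.1 x.2.2
  rw [fixedTerm, dif_pos hx]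
  refine (congrArg (· * _) h1).trans ?_
  rw [mul_assoc]
  exact congrArg (_ * ·) h2.symm

theorem isEquivariantKernel_kappa (hproper : D.source.IsProper D.target D.φ)
    (hsurj : Function.Surjective D.φ) :
    IsEquivariantKernel D.action (naturalRank (B := D.Γ)) D.kappa := by
  have hrev := D.isEquivariant_kappa.revFamily (D.isInvariantRank_naturalRank hproper hsurj)
  have hnat : ∀ (w : W) (z : FixedPoset D.action w), naturalRank z z = 0 := fun w z => by
    have := D.naturalRank_add_coneRank_fixed hproper hsurj w (le_refl z)
    lia
  refine ⟨D.isBounded_kappa hproper hsurj, D.isUnital_kappa, fun z z' h => ?_, fun z z' h => ?_⟩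
  · have := Fintype.ofFinite (Set.Icc z z')
    refine convolution_eq_of_sum_fixedTerm D.isEquivariant_kappa hrev fun k => ?_
    rcases h.eq_or_lt with rfl | hlt
    · rw [deltaFamily, if_pos rfl, map_one]
      refine sum_fixedTerm_eq_one k fun hz => ?_
      rw [D.fixedTerm_kappa_rev hproper hsurj le_rfl k ⟨z, hz⟩ k.2.1, hnat, D.isUnital_kappa,
        map_one, pow_zero, mul_one]
    · rw [deltaFamily, if_neg hlt.ne, map_zero]
      refine (D.isConeSystem_fixedCone hproper hsurj k).sum_fixedTerm k hlt
        -- Modulo two the rank of `[x, z']` is the sum of the ranks of `x` and `z'`; the sign of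
        -- `z'` goes into the constant factor.
        (b := (-1) ^ coneRank (D.fixedUpperPart k) (D.fixedCone k) ⟨z', k.2.2⟩ *
          evPoly k (D.kappa z z' h)) fun x hx => ?_
      rw [D.fixedTerm_kappa_rev hproper hsurj h k x hx,
        neg_one_pow_eq (D.naturalRank_add_coneRank_fixed hproper hsurj k x.2.2), mul_assoc]
  · have := Fintype.ofFinite (Set.Icc z z')
    refine convolution_eq_of_sum_fixedTerm hrev D.isEquivariant_kappa fun k => ?_
    rcases h.eq_or_lt with rfl | hlt
    · rw [deltaFamily, if_pos rfl, map_one]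
      refine sum_fixedTerm_eq_one k fun hz => ?_
      rw [D.fixedTerm_rev_kappa hproper hsurj le_rfl k ⟨z, hz⟩ k.2.1, hnat, D.isUnital_kappa,
        map_one, pow_zero, mul_one]
    · rw [deltaFamily, if_neg hlt.ne, map_zero]
      refine (D.isConeSystem_fixedCone hproper hsurj k).sum_fixedTerm k hlt
        (b := (-1) ^ coneRank (D.fixedUpperPart k) (D.fixedCone k) ⟨z, k.2.1⟩ *
          evPoly k (D.kappa z z' h)) fun x hx => ?_
      rw [D.fixedTerm_rev_kappa hproper hsurj h k x hx,
        neg_one_pow_eq (D.naturalRank_add_coneRank_fixed hproper hsurj k (z := ⟨z, k.2.1⟩) x.2.1),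
        mul_comm ((-1) ^ coneRank _ _ _), mul_assoc]

end EquivariantFanMorphism

theorem lemma4p19 {W V' V : Type*} [Group W] [Finite W]
    [AddCommGroup V'] [Module ℝ V'] [FiniteDimensional ℝ V']
    [AddCommGroup V] [Module ℝ V] [FiniteDimensional ℝ V]
    (D : EquivariantFanMorphism W V' V)
    (hproper : D.source.IsProper D.target D.φ)
    (hsurj : Function.Surjective D.φ) :
    IsEulerianAction D.action ∧
    (IsWeakRankFunction (naturalRank (B := D.Γ)) ∧ IsInvariantRank D.action naturalRank) ∧
    (IsBounded D.action naturalRank D.kappa ∧ IsUnital D.action D.kappa) ∧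
    IsMultiplicative D.action D.kappa ∧
    IsRankAlternating D.action naturalRank D.kappa ∧
    IsEquivariantKernel D.action naturalRank D.kappa :=
  ⟨D.isEulerianAction hproper hsurj,
    ⟨isWeakRankFunction_naturalRank (D.isConeSystem hproper hsurj).isRankFunction,
      D.isInvariantRank_naturalRank hproper hsurj⟩,
    ⟨D.isBounded_kappa hproper hsurj, D.isUnital_kappa⟩, D.isMultiplicative_kappa,
    D.isRankAlternating_kappa hproper hsurj, D.isEquivariantKernel_kappa hproper hsurj⟩

end
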